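/- **Proposition (curvature of the prolonged connection).** Let $M$ be a smooth manifold of dimension $n\ge 2$ and let $\nabla_a$ be a smooth torsion-free affine connection on $M$ whose Ricci tensor $R_{bd}=R_{ab}{}^a{}_d$ is symmetric, where $(\nabla_a\nabla_b-\nabla_b\nabla_a)X^c=R_{ab}{}^c{}_dX^d$. Put $\mathrm{P}_{bd}=\frac1{n-1}R_{bd}$, let $W_{ab}{}^c{}_d=R_{ab}{}^c{}_d-\delta_a{}^c\mathrm{P}_{bd}+\delta_b{}^c\mathrm{P}_{ad}$ be the Weyl curvature and $Y_{abc}=\frac12(\nabla_a\mathrm{P}_{bc}-\nabla_b\mathrm{P}_{ac})$ the Cotton–York tensor. On the bundle $\mathcal T=\bigodot^2TM\oplus TM\oplus\mathbb R$, with sections $(\sigma^{bc},\mu^b,\rho)$, consider the tractor connection $$(\sigma^{bc},\mu^b,\rho)\mapsto\bigl(\nabla_a\sigma^{bc}-\delta_a{}^b\mu^c-\delta_a{}^c\mu^b,\ \nabla_a\mu^b-\delta_a{}^b\rho+\mathrm{P}_{ac}\sigma^{bc},\ \nabla_a\rho+2\mathrm{P}_{ab}\mu^b\bigr)$$ and the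 prolonged connection $$(\sigma^{bc},\mu^b,\rho)\mapsto\bigl(\nabla_a\sigma^{bc}-\delta_a{}^b\mu^c-\delta_a{}^c\mu^b,\ \nabla_a\mu^b-\delta_a{}^b\rho+\mathrm{P}_{ac}\sigma^{bc}-\tfrac1nW_{ac}{}^b{}_d\sigma^{cd},\ \nabla_a\rho+2\mathrm{P}_{ab}\mu^b-\tfrac4nY_{abc}\sigma^{bc}\bigr).$$ Then the curvature of the tractor connection is $$\begin{pmatrix}\sigma^{cd}\\ \mu^c\\ \rho\end{pmatrix}\mapsto\begin{pmatrix}W_{ab}{}^c{}_e\sigma^{de}+W_{ab}{}^d{}_e\sigma^{ce}\\ W_{ab}{}^c{}_d\mu^d+2Y_{abd}\sigma^{cd}\\ 4Y_{abc}\mu^c\end{pmatrix},$$ and the curvature of the prolonged connection is $$\begin{pmatrix}\sigma^{cd}\\ \mu^c\\ \rho\end{pmatrix}\mapsto\begin{pmatrix}W_{ab}{}^c{}_e\sigma^{de}+W_{ab}{}^d{}_e\sigma^{ce}\\ W_{ab}{}^c{}_d\mu^d+2Y_{abd}\sigma^{cd}\\ 4Y_{abc}\mu^c\end{pmatrix}+\frac1n\begin{pmatrix}\delta_a{}^cU_b{}^d+\delta_a{}^dU_b{}^c-\delta_b{}^cU_a{}^d-\delta_b{}^dU_a{}^c\\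 \ast\\ \ast\end{pmatrix},$$ where $U_b{}^d=W_{be}{}^d{}_f\sigma^{ef}$ and each $\ast$ is an unspecified expression that is skew in $a,b$ and depends pointwise and linearly on $(\sigma,\mu,\rho)$. -/

import Mathlib

open scoped Manifold ContDiff Bundle

noncomputable section

namespace ProjProlong

variable {n : ℕ} {M : Type*} [TopologicalSpace M] [ChartedSpace (EuclideanSpace ℝ (Fin n)) M]

/-! ### Tangent vectors, covectors and the fibres of the bundle `⊙² TM ⊕ TM ⊕ ℝ` -/

/-- The tangent space at `x`. -/
abbrev Tan (n : ℕ) {M : Type*} [TopologicalSpace M]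
    [ChartedSpace (EuclideanSpace ℝ (Fin n)) M] (x : M) : Type :=
  TangentSpace (𝓡 n) x

/-- The cotangent space at `x`. -/
abbrev Cot (n : ℕ) {M : Type*} [TopologicalSpace M]
    [ChartedSpace (EuclideanSpace ℝ (Fin n)) M] (x : M) : Type :=
  Tan n x →L[ℝ] Bundle.Trivial M ℝ x

/-- Contravariant 2-tensors `σ^{bc}` at `x`, as linear maps `α_c ↦ σ^{bc} α_c` from covectors to
vectors. -/
abbrev Con2 (n : ℕ) {M : Type*} [TopologicalSpace M]
    [ChartedSpace (EuclideanSpace ℝ (Fin n)) M] (x : M) : Type :=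
  Cot n x →L[ℝ] Tan n x

/-- Triples `(σ^{bc}, μ^b, ρ)` at `x`; the fibre of `⊙² TM ⊕ TM ⊕ ℝ` consists of those whose
first entry is symmetric. -/
abbrev Fib (n : ℕ) {M : Type*} [TopologicalSpace M]
    [ChartedSpace (EuclideanSpace ℝ (Fin n)) M] (x : M) : Type :=
  Con2 n x × Tan n x × ℝ

/-- Symmetry `σ^{bc} = σ^{cb}`. -/
def IsSymm2 {x : M} (τ : Con2 n x) : Prop :=
  ∀ α β : Cot n x, α (τ β) = β (τ α)

/-- Evaluation of covectors on a tangent vector. -/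
def evalCot {x : M} (v : Tan n x) : Cot n x →L[ℝ] ℝ :=
  (ContinuousLinearMap.apply ℝ ℝ (v : EuclideanSpace ℝ (Fin n)) :
    (EuclideanSpace ℝ (Fin n) →L[ℝ] ℝ) →L[ℝ] ℝ)

@[simp]
theorem evalCot_apply {x : M} (v : Tan n x) (α : Cot n x) : evalCot v α = α v := rfl

/-- `v^b w^c + w^b v^c`. -/
def symProd {x : M} (v w : Tan n x) : Con2 n x :=
  (evalCot v).smulRight w + (evalCot w).smulRight v

/-- A basis `e_i` of the tangent space at `x`, used to write contractions of indices. -/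
def tanBasis (x : M) : Module.Basis (Fin n) ℝ (Tan n x) :=
  (EuclideanSpace.basisFun (Fin n) ℝ).toBasis

/-- The dual basis `e^i` of the cotangent space at `x`. -/
def cotBasis (x : M) (i : Fin n) : Cot n x :=
  (EuclideanSpace.proj i : EuclideanSpace ℝ (Fin n) →L[ℝ] ℝ)

theorem cotBasis_tanBasis (x : M) (i j : Fin n) :
    cotBasis x i (tanBasis x j) = if i = j then (1 : ℝ) else 0 := by
  have h : cotBasis x i (tanBasis x j) = (EuclideanSpace.basisFun (Fin n) ℝ j) i := by
    simp only [tanBasis, cotBasis]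
    exact congrArg (fun v : EuclideanSpace ℝ (Fin n) => v i)
      (congrFun (OrthonormalBasis.coe_toBasis (EuclideanSpace.basisFun (Fin n) ℝ)) j)
  rw [h]
  simp

/-- The extension of a tangent vector at `x` to a vector field that is constant in the
preferred chart at `x`, hence smooth near `x`. -/
def extTan [IsManifold (𝓡 n) ∞ M] {x : M} (v : Tan n x) : Π y : M, Tan n y :=
  FiberBundle.extend (EuclideanSpace ℝ (Fin n)) v

/-- The extension of a covector at `x` to a 1-form that is smooth near `x`. -/
def extCot [IsManifold (𝓡 n) ∞ M] {x : M} (α : Cot n x) : Π y : M, Cot n y :=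
  FiberBundle.extend (EuclideanSpace ℝ (Fin n) →L[ℝ] ℝ) α

/-! ### Smooth sections -/

/-- Smooth vector fields. -/
def SmoothTan [IsManifold (𝓡 n) ∞ M] (X : Π x : M, Tan n x) : Prop :=
  ContMDiff (𝓡 n) ((𝓡 n).prod 𝓘(ℝ, EuclideanSpace ℝ (Fin n))) ∞
    (fun x ↦ Bundle.TotalSpace.mk' (EuclideanSpace ℝ (Fin n)) x (X x))

/-- Smooth contravariant 2-tensor fields, that is, smooth sections of `Hom(T*M, TM)`. -/
def SmoothCon2 [IsManifold (𝓡 n) ∞ M] (τ : Π x : M, Con2 n x) : Prop :=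
  ContMDiff (𝓡 n) ((𝓡 n).prod 𝓘(ℝ, (EuclideanSpace ℝ (Fin n) →L[ℝ] ℝ) →L[ℝ]
    EuclideanSpace ℝ (Fin n))) ∞
    (fun x ↦ Bundle.TotalSpace.mk' ((EuclideanSpace ℝ (Fin n) →L[ℝ] ℝ) →L[ℝ]
      EuclideanSpace ℝ (Fin n)) x (τ x))

/-- Smooth sections `(σ^{bc}, μ^b, ρ)` of `⊙² TM ⊕ TM ⊕ ℝ`. -/
structure IsSmoothSection [IsManifold (𝓡 n) ∞ M] (s : Π x : M, Fib n x) : Prop where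
  symm : ∀ x, IsSymm2 (s x).1
  smooth_top : SmoothCon2 fun x ↦ (s x).1
  smooth_mid : SmoothTan fun x ↦ (s x).2.1
  smooth_bot : ContMDiff (𝓡 n) 𝓘(ℝ, ℝ) ∞ fun x ↦ (s x).2.2

/-! ### Affine connections: induced derivatives, curvature and its parts -/

/-- Affine connections on `M`; `∇_u Y` at `x` is `D Y x u`. -/
abbrev Conn (n : ℕ) (M : Type*) [TopologicalSpace M]
    [ChartedSpace (EuclideanSpace ℝ (Fin n)) M] [IsManifold (𝓡 n) ∞ M] :=
  CovariantDerivative (𝓡 n) (EuclideanSpace ℝ (Fin n)) (fun x : M ↦ TangentSpace (𝓡 n) x)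

/-- The differential of a function in the direction `u`. -/
def dFun (f : M → ℝ) (x : M) (u : Tan n x) : ℝ :=
  mvfderiv (𝓡 n) f x u

variable [IsManifold (𝓡 n) ∞ M] (D : Conn n M)

/-- The induced derivative of 1-forms, `(∇_u α)(v) = u(α(V)) - α(∇_u V)`. -/
def covCot (α : Π x : M, Cot n x) (x : M) (u : Tan n x) : Cot n x :=
  ∑ i, (dFun (fun y ↦ α y (extTan (tanBasis x i) y)) x u
    - α x (D (extTan (tanBasis x i)) x u) : ℝ) • cotBasis x i

/-- The induced derivative of contravariant 2-tensors,
`(∇_u σ)(α) = ∇_u (σ(α)) - σ(∇_u α)`. -/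
def covCon2 (τ : Π x : M, Con2 n x) (x : M) (u : Tan n x) : Con2 n x :=
  ∑ i, (evalCot (tanBasis x i)).smulRight
    (D (fun y ↦ τ y (extCot (cotBasis x i) y)) x u
      - τ x (covCot D (extCot (cotBasis x i)) x u))

/-- `∇_X ∇_Y Z - ∇_Y ∇_X Z - ∇_{[X,Y]} Z`. -/
def curvField (X Y Z : Π x : M, Tan n x) (x : M) : Tan n x :=
  D (fun y ↦ D Z y (Y y)) x (X x) - D (fun y ↦ D Z y (X y)) x (Y x)
    - D Z x (VectorField.mlieBracket (𝓡 n) X Y x)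

/-- The curvature `R_{ab}{}^c{}_d u^a v^b w^d` of a torsion-free connection. -/
def riem {x : M} (u v w : Tan n x) : Tan n x :=
  curvField D (extTan u) (extTan v) (extTan w) x

/-- The Ricci tensor `R_{ab}{}^a{}_d v^b w^d`. -/
def ric {x : M} (v w : Tan n x) : ℝ :=
  ∑ i, cotBasis x i (riem D (tanBasis x i) v w)

/-- The Schouten tensor `P_{ab}`, with `(n - 1) P_{ab} = R_{ab}`. -/
def schouten {x : M} (v w : Tan n x) : ℝ :=
  ((n : ℝ) - 1)⁻¹ * ric D v w

/-- The Weyl curvature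
`W_{ab}{}^c{}_d = R_{ab}{}^c{}_d - δ_a{}^c P_{bd} + δ_b{}^c P_{ad}` applied to `u^a v^b w^d`. -/
def weyl {x : M} (u v w : Tan n x) : Tan n x :=
  riem D u v w - schouten D v w • u + schouten D u w • v

/-- `(∇_a P_{bc}) u^a v^b w^c`. -/
def covSchouten {x : M} (u v w : Tan n x) : ℝ :=
  dFun (fun y ↦ schouten D (extTan v y) (extTan w y)) x u
    - schouten D (D (extTan v) x u) w - schouten D v (D (extTan w) x u)

/-- The Cotton-York tensor `Y_{abc} = (∇_a P_{bc} - ∇_b P_{ac}) / 2`. -/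
def cotton {x : M} (u v w : Tan n x) : ℝ :=
  (covSchouten D u v w - covSchouten D v u w) / 2

/-! ### Contractions with `σ^{bc}` -/

/-- `P_{ac} σ^{bc} u^a`. -/
def schoutenCon {x : M} (u : Tan n x) (τ : Con2 n x) : Tan n x :=
  ∑ i, schouten D u (tanBasis x i) • τ (cotBasis x i)

/-- `U_b{}^d v^b`, where `U_b{}^d = W_{be}{}^d{}_f σ^{ef}`. -/
def weylCon {x : M} (v : Tan n x) (τ : Con2 n x) : Tan n x :=
  ∑ i, weyl D v (tanBasis x i) (τ (cotBasis x i))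

/-- `Y_{abc} σ^{bc} u^a`. -/
def cottonCon {x : M} (u : Tan n x) (τ : Con2 n x) : ℝ :=
  ∑ i, cotton D u (tanBasis x i) (τ (cotBasis x i))

/-! ### The connections on `⊙² TM ⊕ TM ⊕ ℝ` and their curvature -/

/-- The tractor connection
`(∇_a σ^{bc} - δ_a{}^b μ^c - δ_a{}^c μ^b, ∇_a μ^b - δ_a{}^b ρ + P_{ac} σ^{bc},
∇_a ρ + 2 P_{ab} μ^b)`, contracted with `u^a`. -/
def tractorConn (s : Π x : M, Fib n x) (x : M) (u : Tan n x) : Fib n x :=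
  (covCon2 D (fun y ↦ (s y).1) x u - symProd u (s x).2.1,
    D (fun y ↦ (s y).2.1) x u - (s x).2.2 • u + schoutenCon D u (s x).1,
    dFun (fun y ↦ (s y).2.2) x u + 2 * schouten D u (s x).2.1)

/-- The prolonged connection: the tractor connection minus
`(1/n) (0, W_{ac}{}^b{}_d σ^{cd}, 4 Y_{abc} σ^{bc})`. -/
def prolongedConn (s : Π x : M, Fib n x) (x : M) (u : Tan n x) : Fib n x :=
  (covCon2 D (fun y ↦ (s y).1) x u - symProd u (s x).2.1,
    D (fun y ↦ (s y).2.1) x u - (s x).2.2 • u + schoutenCon D u (s x).1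
      - (1 / (n : ℝ)) • weylCon D u (s x).1,
    dFun (fun y ↦ (s y).2.2) x u + 2 * schouten D u (s x).2.1
      - (4 / (n : ℝ)) * cottonCon D u (s x).1)

/-- The curvature `∇_X ∇_Y s - ∇_Y ∇_X s - ∇_{[X,Y]} s` of an operator `∇` on triples. -/
def fibCurv (N : (Π x : M, Fib n x) → Π x : M, Tan n x → Fib n x)
    (X Y : Π x : M, Tan n x) (s : Π x : M, Fib n x) (x : M) : Fib n x :=
  N (fun y ↦ N s y (Y y)) x (X x) - N (fun y ↦ N s y (X y)) x (Y x)
    - N s x (VectorField.mlieBracket (𝓡 n) X Y x)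

/-- The triple
`(W_{ab}{}^c{}_e σ^{de} + W_{ab}{}^d{}_e σ^{ce}, W_{ab}{}^c{}_d μ^d + 2 Y_{abd} σ^{cd},
4 Y_{abc} μ^c)`, contracted with `u^a v^b`. -/
def tractorCurv {x : M} (u v : Tan n x) (t : Fib n x) : Fib n x :=
  (∑ i, symProd (weyl D u v (tanBasis x i)) (t.1 (cotBasis x i)),
    weyl D u v t.2.1 + (2 : ℝ) • ∑ i, cotton D u v (tanBasis x i) • t.1 (cotBasis x i),
    4 * cotton D u v t.2.1)

/-- `δ_a{}^c U_b{}^d + δ_a{}^d U_b{}^c - δ_b{}^c U_a{}^d - δ_b{}^d U_a{}^c`, contracted with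
`u^a v^b`. -/
def correctionTop {x : M} (u v : Tan n x) (τ : Con2 n x) : Con2 n x :=
  symProd u (weylCon D v τ) - symProd v (weylCon D u τ)

end ProjProlong

end

/-! Let ∇ be the tractor connection and Φ_a(σ, μ, ρ) = -(0, W_{ac}^b_d σ^{cd}, 4 Y_{abc} σ^{bc}).
Both connections are of the form ∇ + cΦ (`modConn`), with c = 0 or c = 1/n. Since Φ reads only σ and
writes only into the other two slots, Φ_a Φ_b = 0. Hence the curvature is affine in c: the curvature
of ∇ plus c times the skew derivative of Φ. In the top slot this derivative is algebraic: -U enters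
through the μ-terms of ∇ and gives `correctionTop`. In the other slots it contains ∇W and ∇Y, and
only tensoriality and skewness are needed.

For c = 0, first-order terms are symmetric in the two directions and cancel, and terms in ∇_X Y are
absorbed by ∇_{[X,Y]} because the torsion vanishes. What remains is algebra. In the top slot the
Ricci identity (`ricci_con2`) gives R on both indices of σ, and the P-terms turn R into W because σ
is symmetric. In the middle slot the P-terms in μ turn R into W, and the skew part of ∇P gives 2Y.
In the bottom slot the skew part of 2∇P gives 4Y, while P_{ab} ρ and P_{ac} P_{bd} σ^{cd} are
symmetric in a, b and drop out. The three slots are `modConn_top`, `modConn_mid` and `modConn_bot`.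

The remaining work shows that objects defined at a point by chart-constant extensions are tensors
that can be evaluated on, and differentiated along, arbitrary fields. It is done for germs: an
additive, local operator that is linear over smooth functions (`TensorialNear`) depends only on the
value of its argument at the point, by expansion in a local frame with dual coframe. -/

noncomputable section

namespace ProjProlong

open Filter Topology

/-! ### Germs of smooth functions and fields, dual frames, function-linear operators. -/

section

variable {n : ℕ} {M : Type*} [TopologicalSpace M] [ChartedSpace (EuclideanSpace ℝ (Fin n)) M]

/-- Functions that are smooth in a neighbourhood of `x`. -/
def SmoothFunNear (n : ℕ) {M : Type*} [TopologicalSpace M]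
    [ChartedSpace (EuclideanSpace ℝ (Fin n)) M] (f : M → ℝ) (x : M) : Prop :=
  ∀ᶠ y in 𝓝 x, ContMDiffAt (𝓡 n) 𝓘(ℝ, ℝ) ∞ f y

theorem SmoothFunNear.eventually {f : M → ℝ} {x : M} (h : SmoothFunNear n f x) :
    ∀ᶠ y in 𝓝 x, SmoothFunNear n f y :=
  eventually_eventually_nhds.2 h

theorem SmoothFunNear.mdiff {f : M → ℝ} {x : M} (h : SmoothFunNear n f x) :
    MDifferentiableAt (𝓡 n) 𝓘(ℝ, ℝ) f x :=
  h.self_of_nhds.mdifferentiableAt (by simp)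

theorem SmoothFunNear.congr {f g : M → ℝ} {x : M} (h : SmoothFunNear n f x)
    (hfg : ∀ᶠ y in 𝓝 x, g y = f y) : SmoothFunNear n g x := by
  filter_upwards [h, eventually_eventually_nhds.2 hfg] with y hy hy'
  exact hy.congr_of_eventuallyEq hy'

theorem SmoothFunNear.add {f g : M → ℝ} {x : M} (hf : SmoothFunNear n f x)
    (hg : SmoothFunNear n g x) : SmoothFunNear n (fun y ↦ f y + g y) x := by
  filter_upwards [hf, hg] with y hy hy'
  exact hy.add hy'

theorem SmoothFunNear.sub {f g : M → ℝ} {x : M} (hf : SmoothFunNear n f x)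
    (hg : SmoothFunNear n g x) : SmoothFunNear n (fun y ↦ f y - g y) x := by
  filter_upwards [hf, hg] with y hy hy'
  exact hy.sub hy'

theorem SmoothFunNear.mul {f g : M → ℝ} {x : M} (hf : SmoothFunNear n f x)
    (hg : SmoothFunNear n g x) : SmoothFunNear n (fun y ↦ f y * g y) x := by
  filter_upwards [hf, hg] with y hy hy'
  exact hy.mul hy'

theorem smoothFunNear_const (c : ℝ) (x : M) : SmoothFunNear n (fun _ ↦ c) x :=
  Eventually.of_forall fun _ ↦ contMDiffAt_const

theorem SmoothFunNear.sum {ι : Type*} [Fintype ι] {f : ι → M → ℝ} {x : M}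
    (hf : ∀ i, SmoothFunNear n (f i) x) : SmoothFunNear n (fun y ↦ ∑ i, f i y) x := by
  filter_upwards [eventually_all.2 hf] with y hy
  exact contMDiffAt_finsetSum fun i _ ↦ hy i

/-! ### Dual bases -/

/-- A family of vectors and covectors in duality at `y` is a basis with its dual basis. -/
theorem dual_expand {y : M} {e : Fin n → Tan n y} {ε : Fin n → Cot n y}
    (h : ∀ i j, ε i (e j) = if i = j then (1 : ℝ) else 0) (v : Tan n y) :
    v = ∑ i, (ε i v : ℝ) • e i := by
  have hli : LinearIndependent ℝ e := by
    rw [Fintype.linearIndependent_iff]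
    intro g hg i
    have := congrArg (ε i) hg
    rw [map_sum] at this
    simpa [h] using this
  have hcard : Fintype.card (Fin n) = Module.finrank ℝ (Tan n y) := by
    rw [Fintype.card_fin]
    exact (finrank_euclideanSpace_fin (𝕜 := ℝ) (n := n)).symm
  have : FiniteDimensional ℝ (Tan n y) :=
    inferInstanceAs (FiniteDimensional ℝ (EuclideanSpace ℝ (Fin n)))
  have hv : v ∈ Submodule.span ℝ (Set.range e) := by
    rw [hli.span_eq_top_of_card_eq_finrank' hcard]
    trivial
  obtain ⟨c, rfl⟩ := (Submodule.mem_span_range_iff_exists_fun ℝ).1 hv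
  refine Finset.sum_congr rfl fun i _ ↦ ?_
  rw [map_sum]
  simp [h]

theorem dual_expand_cot {y : M} {e : Fin n → Tan n y} {ε : Fin n → Cot n y}
    (h : ∀ i j, ε i (e j) = if i = j then (1 : ℝ) else 0) (α : Cot n y) :
    α = ∑ i, (α (e i) : ℝ) • ε i := by
  refine ContinuousLinearMap.ext fun v ↦ ?_
  conv_lhs => rw [dual_expand h v]
  rw [map_sum, sum_apply]
  refine Finset.sum_congr rfl fun i _ ↦ ?_
  rw [map_smul, smul_apply, smul_eq_mul, smul_eq_mul, mul_comm]

/-- Contractions may be computed in any pair of dual bases. -/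
theorem contract_eq {V : Type*} [AddCommGroup V] [Module ℝ V] {y : M}
    {e e' : Fin n → Tan n y} {ε ε' : Fin n → Cot n y}
    (h : ∀ i j, ε i (e j) = if i = j then (1 : ℝ) else 0)
    (h' : ∀ i j, ε' i (e' j) = if i = j then (1 : ℝ) else 0)
    (f : Tan n y → Cot n y → V) (hf₁ : ∀ α, IsLinearMap ℝ fun v ↦ f v α)
    (hf₂ : ∀ v, IsLinearMap ℝ fun α ↦ f v α) :
    ∑ i, f (e i) (ε i) = ∑ i, f (e' i) (ε' i) := by
  have h1 : ∀ i, f (e i) (ε i) = ∑ j, (ε i (e' j) : ℝ) • f (e i) (ε' j) := fun i ↦ by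
    conv_lhs => rw [dual_expand_cot h' (ε i)]
    rw [← (hf₂ (e i)).mk'_apply, map_sum]
    simp
  have h2 : ∀ j, f (e' j) (ε' j) = ∑ i, (ε i (e' j) : ℝ) • f (e i) (ε' j) := fun j ↦ by
    conv_lhs => rw [dual_expand h (e' j)]
    rw [← (hf₁ (ε' j)).mk'_apply, map_sum]
    simp
  simp_rw [h1, h2]
  exact Finset.sum_comm

theorem con2_apply_eq_sum {y : M} {e : Fin n → Tan n y} {ε : Fin n → Cot n y}
    (h : ∀ i j, ε i (e j) = if i = j then (1 : ℝ) else 0) (τ : Con2 n y) (α : Cot n y) :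
    τ α = ∑ i, (α (e i) : ℝ) • τ (ε i) := by
  conv_lhs => rw [dual_expand_cot h α]
  simp [map_sum]

theorem con2_eq_sum {y : M} {e : Fin n → Tan n y} {ε : Fin n → Cot n y}
    (h : ∀ i j, ε i (e j) = if i = j then (1 : ℝ) else 0) (τ : Con2 n y) :
    τ = ∑ p : Fin n × Fin n, (ε p.1 (τ (ε p.2)) : ℝ) • (evalCot (e p.2)).smulRight (e p.1) := by
  refine ContinuousLinearMap.ext fun α ↦ ?_
  rw [con2_apply_eq_sum h, sum_apply, Fintype.sum_prod_type_right]
  refine Finset.sum_congr rfl fun j _ ↦ ?_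
  conv_lhs => rw [dual_expand h (τ (ε j))]
  rw [Finset.smul_sum]
  refine Finset.sum_congr rfl fun i _ ↦ ?_
  simp [smul_smul, mul_comm]

/-! ### Tensorial operations -/

/-- An operation `Φ` on the sections satisfying `S`, near `x`, that is additive, linear over smooth
functions and local. -/
structure TensorialNear (n : ℕ) {M : Type*} [TopologicalSpace M]
    [ChartedSpace (EuclideanSpace ℝ (Fin n)) M] {V : M → Type*} [∀ x, AddCommGroup (V x)]
    [∀ x, Module ℝ (V x)] {A : Type*} [AddCommGroup A] [Module ℝ A]
    (S : (Π x, V x) → Prop) (Φ : (Π x, V x) → A) (x : M) : Prop where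
  add : ∀ {σ τ}, S σ → S τ → Φ (fun y ↦ σ y + τ y) = Φ σ + Φ τ
  smul : ∀ {f : M → ℝ} {σ}, SmoothFunNear n f x → S σ → Φ (fun y ↦ f y • σ y) = f x • Φ σ
  congr : ∀ {σ τ}, S σ → S τ → (∀ᶠ y in 𝓝 x, σ y = τ y) → Φ σ = Φ τ

section

variable {V : M → Type*} [∀ x, AddCommGroup (V x)]
  [∀ x, Module ℝ (V x)] {A : Type*} [AddCommGroup A] [Module ℝ A]
  {S : (Π x, V x) → Prop} {Φ : (Π x, V x) → A} {x : M}

/-- The rules for Φ apply only to sections in S, so the induction carries membership of the partial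
sums in S along with the formula. -/
theorem TensorialNear.eq_sum (h : TensorialNear n S Φ x) {ι : Type*} [Fintype ι]
    (hadd : ∀ {σ τ}, S σ → S τ → S fun y ↦ σ y + τ y)
    (hsmul : ∀ {f : M → ℝ} {σ}, SmoothFunNear n f x → S σ → S fun y ↦ f y • σ y)
    {b : ι → Π y, V y} (hb : ∀ i, S (b i)) {σ : Π y, V y} (hσ : S σ) {c : ι → M → ℝ}
    (hc : ∀ i, SmoothFunNear n (c i) x) (hexp : ∀ᶠ y in 𝓝 x, σ y = ∑ i, c i y • b i y) :
    Φ σ = ∑ i, c i x • Φ (b i) := by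
  classical
  have key : ∀ s : Finset ι, S (fun y ↦ ∑ i ∈ s, c i y • b i y) ∧
      Φ (fun y ↦ ∑ i ∈ s, c i y • b i y) = ∑ i ∈ s, c i x • Φ (b i) := by
    intro s
    induction s using Finset.induction_on with
    | empty =>
      -- That the zero section lies in S is not assumed; it is obtained as 0 • σ.
      have h0 := hsmul (smoothFunNear_const 0 x) hσ
      have h1 := h.smul (smoothFunNear_const 0 x) hσ
      simp only [zero_smul] at h0 h1
      simpa using ⟨h0, h1⟩
    | insert a s ha ih =>
      simp only [Finset.sum_insert ha]
      have h1 := hsmul (hc a) (hb a)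
      exact ⟨hadd h1 ih.1, by rw [h.add h1 ih.1, h.smul (hc a) (hb a), ih.2]⟩
  rw [h.congr hσ (key Finset.univ).1 hexp, (key Finset.univ).2]

end

variable [IsManifold (𝓡 n) ∞ M]

/-- Vector fields that are smooth in a neighbourhood of `x`. -/
def SmoothTanNear (X : Π x : M, Tan n x) (x : M) : Prop :=
  ∀ᶠ y in 𝓝 x, ContMDiffAt (𝓡 n) ((𝓡 n).prod 𝓘(ℝ, EuclideanSpace ℝ (Fin n))) ∞
    (fun z ↦ Bundle.TotalSpace.mk' (EuclideanSpace ℝ (Fin n)) z (X z)) y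

/-- 1-forms that are smooth in a neighbourhood of `x`, tested on vector fields. -/
def SmoothCotNear (α : Π x : M, Cot n x) (x : M) : Prop :=
  ∀ᶠ y in 𝓝 x, ∀ X : Π x : M, Tan n x, SmoothTanNear X y → SmoothFunNear n (fun z ↦ α z (X z)) y

/-- Contravariant 2-tensors that are smooth in a neighbourhood of `x`, tested on 1-forms. -/
def SmoothCon2Near (τ : Π x : M, Con2 n x) (x : M) : Prop :=
  ∀ᶠ y in 𝓝 x, ∀ α : Π x : M, Cot n x, SmoothCotNear α y → SmoothTanNear (fun z ↦ τ z (α z)) y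

theorem SmoothTanNear.eventually {X : Π x : M, Tan n x} {x : M} (h : SmoothTanNear X x) :
    ∀ᶠ y in 𝓝 x, SmoothTanNear X y :=
  eventually_eventually_nhds.2 h

theorem SmoothCotNear.eventually {α : Π x : M, Cot n x} {x : M} (h : SmoothCotNear α x) :
    ∀ᶠ y in 𝓝 x, SmoothCotNear α y :=
  eventually_eventually_nhds.2 h

theorem SmoothCon2Near.eventually {τ : Π x : M, Con2 n x} {x : M} (h : SmoothCon2Near τ x) :
    ∀ᶠ y in 𝓝 x, SmoothCon2Near τ y :=
  eventually_eventually_nhds.2 h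

theorem SmoothCotNear.apply {α : Π x : M, Cot n x} {X : Π x : M, Tan n x} {x : M}
    (h : SmoothCotNear α x) (hX : SmoothTanNear X x) : SmoothFunNear n (fun z ↦ α z (X z)) x :=
  h.self_of_nhds X hX

theorem SmoothCon2Near.apply {τ : Π x : M, Con2 n x} {α : Π x : M, Cot n x} {x : M}
    (h : SmoothCon2Near τ x) (hα : SmoothCotNear α x) : SmoothTanNear (fun z ↦ τ z (α z)) x :=
  h.self_of_nhds α hα

theorem SmoothTanNear.mdiff {X : Π x : M, Tan n x} {x : M} (h : SmoothTanNear X x) :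
    MDifferentiableAt (𝓡 n) ((𝓡 n).prod 𝓘(ℝ, EuclideanSpace ℝ (Fin n)))
      (fun z ↦ Bundle.TotalSpace.mk' (EuclideanSpace ℝ (Fin n)) z (X z)) x :=
  h.self_of_nhds.mdifferentiableAt (by simp)

theorem SmoothTanNear.congr {X Y : Π x : M, Tan n x} {x : M} (h : SmoothTanNear X x)
    (hXY : ∀ᶠ y in 𝓝 x, Y y = X y) : SmoothTanNear Y x := by
  filter_upwards [h, eventually_eventually_nhds.2 hXY] with y hy hy'
  refine hy.congr_of_eventuallyEq ?_
  filter_upwards [hy'] with z hz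
  rw [hz]

theorem SmoothTanNear.add {X Y : Π x : M, Tan n x} {x : M} (hX : SmoothTanNear X x)
    (hY : SmoothTanNear Y x) : SmoothTanNear (fun y ↦ X y + Y y) x := by
  filter_upwards [hX, hY] with y hy hy'
  exact ContMDiffAt.add_section hy hy'

theorem SmoothTanNear.sub {X Y : Π x : M, Tan n x} {x : M} (hX : SmoothTanNear X x)
    (hY : SmoothTanNear Y x) : SmoothTanNear (fun y ↦ X y - Y y) x := by
  filter_upwards [hX, hY] with y hy hy'
  exact ContMDiffAt.sub_section hy hy'

theorem SmoothTanNear.smul {f : M → ℝ} {X : Π x : M, Tan n x} {x : M} (hf : SmoothFunNear n f x)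
    (hX : SmoothTanNear X x) : SmoothTanNear (fun y ↦ f y • X y) x := by
  filter_upwards [hf, hX] with y hy hy'
  exact ContMDiffAt.smul_section hy hy'

theorem SmoothTanNear.sum {ι : Type*} [Fintype ι] {X : ι → Π x : M, Tan n x} {x : M}
    (hX : ∀ i, SmoothTanNear (X i) x) : SmoothTanNear (fun y ↦ ∑ i, X i y) x := by
  filter_upwards [eventually_all.2 hX] with y hy
  exact ContMDiffAt.sum_section fun i _ ↦ hy i

theorem SmoothTan.near {X : Π x : M, Tan n x} (hX : SmoothTan X) (x : M) : SmoothTanNear X x :=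
  Eventually.of_forall fun y ↦ hX y

/-! ### Frames and coframes near a point -/

theorem smoothTanNear_extTan {x : M} (v : Tan n x) : SmoothTanNear (extTan v) x := by
  obtain ⟨s, hs, h⟩ := FiberBundle.exists_contMDiffOn_extend (k := ∞) (𝓡 n)
    (EuclideanSpace ℝ (Fin n)) v
  filter_upwards [eventually_mem_nhds_iff.2 hs] with y hy
  exact h.contMDiffAt hy

@[simp]
theorem extTan_self {x : M} (v : Tan n x) : extTan v x = v :=
  FiberBundle.extend_apply_self _ v

@[simp]
theorem extCot_self {x : M} (α : Cot n x) : extCot α x = α :=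
  FiberBundle.extend_apply_self _ α

theorem smoothCotNear_extCot {x : M} (α : Cot n x) : SmoothCotNear (extCot α) x := by
  obtain ⟨s, hs, h⟩ := FiberBundle.exists_contMDiffOn_extend (k := ∞) (𝓡 n)
    (EuclideanSpace ℝ (Fin n) →L[ℝ] ℝ) α
  filter_upwards [eventually_mem_nhds_iff.2 (eventually_mem_nhds_iff.2 hs)] with y hy X hX
  filter_upwards [hX, hy] with z hz hz'
  have := ContMDiffAt.clm_bundle_apply (h.contMDiffAt hz') hz
  rw [Bundle.contMDiffAt_totalSpace] at this
  exact this.2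

/-- Both extensions are constant in the trivializations at x, and the trivialization of the Hom
bundle is conjugation by that of TM, so the pairing is constant on the base set. This is what makes
`coframe` dual to `frame` near x and not only at x. -/
theorem extCot_extTan {x : M} (α : Cot n x) (v : Tan n x) :
    ∀ᶠ y in 𝓝 x, extCot α y (extTan v y) = α v := by
  set t := trivializationAt (EuclideanSpace ℝ (Fin n)) (TangentSpace (𝓡 n) : M → Type) x with ht
  have hx : x ∈ t.baseSet := FiberBundle.mem_baseSet_trivializationAt' x
  set t₁ := trivializationAt ℝ (Bundle.Trivial M ℝ) x with ht₁
  filter_upwards [t.open_baseSet.mem_nhds hx] with y hy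
  have key : ∀ L : EuclideanSpace ℝ (Fin n) →L[ℝ] ℝ,
      (trivializationAt (EuclideanSpace ℝ (Fin n) →L[ℝ] ℝ) (fun y : M ↦ Cot n y) x).symm y L
        = (t₁.symmL ℝ y).comp (L.comp (t.continuousLinearMapAt ℝ y)) := fun L ↦
    Bundle.Pretrivialization.continuousLinearMap_symm_apply' (RingHom.id ℝ) t t₁
      ⟨hy, Set.mem_univ y⟩ L
  have hv : t.continuousLinearMapAt ℝ y (t.symm y (t ⟨x, v⟩).2) = (t ⟨x, v⟩).2 := by
    have := t.continuousLinearMapAt_symmL (R := ℝ) hy (t ⟨x, v⟩).2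
    rwa [t.symmL_apply hy] at this
  simp only [extCot, extTan, FiberBundle.extend]
  rw [key]
  simp only [ContinuousLinearMap.comp_apply]
  rw [hv]
  have hx' : t.symmL ℝ x (t ⟨x, v⟩).2 = v := by
    rw [t.symmL_apply hx]
    exact t.symm_apply_apply_mk hx v
  have h2 : (trivializationAt (EuclideanSpace ℝ (Fin n) →L[ℝ] ℝ) (fun y : M ↦ Cot n y) x
      ⟨x, α⟩).2 (t ⟨x, v⟩).2 = t₁.continuousLinearMapAt ℝ x (α (t.symmL ℝ x (t ⟨x, v⟩).2)) := rfl
  rw [h2, hx']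
  -- The trivialization of the trivial line bundle is the identity on fibres, in both directions.
  have h3 : ∀ (z : M) (r : ℝ), t₁.symmL ℝ z r = r := fun z r ↦
    (t₁.symmL_apply (Set.mem_univ z) r).trans
      (t₁.symm_apply_apply_mk (Set.mem_univ z) r)
  have h4 : ∀ (z : M) (r : ℝ), t₁.continuousLinearMapAt ℝ z r = r := fun z r ↦ by
    have := t₁.continuousLinearMapAt_symmL (R := ℝ) (Set.mem_univ z) r
    rwa [h3] at this
  exact (h3 _ _).trans (h4 _ _)

/-- The local frame at `x` that is constant in the preferred chart. -/
def frame (x : M) (i : Fin n) : Π y : M, Tan n y :=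
  extTan (tanBasis x i)

/-- The coframe dual to `frame`. -/
def coframe (x : M) (i : Fin n) : Π y : M, Cot n y :=
  extCot (cotBasis x i)

theorem smoothTanNear_frame (x : M) (i : Fin n) : SmoothTanNear (frame x i) x :=
  smoothTanNear_extTan _

theorem smoothCotNear_coframe (x : M) (i : Fin n) : SmoothCotNear (coframe x i) x :=
  smoothCotNear_extCot _

@[simp]
theorem frame_self (x : M) (i : Fin n) : frame x i x = tanBasis x i :=
  extTan_self _

@[simp]
theorem coframe_self (x : M) (i : Fin n) : coframe x i x = cotBasis x i :=
  extCot_self _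

theorem coframe_frame (x : M) :
    ∀ᶠ y in 𝓝 x, ∀ i j : Fin n, coframe x i y (frame x j y) = if i = j then (1 : ℝ) else 0 := by
  simp only [eventually_all]
  intro i j
  rw [← cotBasis_tanBasis x i j]
  exact extCot_extTan _ _

theorem SmoothFunNear.coframe {X : Π x : M, Tan n x} {x : M} (hX : SmoothTanNear X x) (i : Fin n) :
    SmoothFunNear n (fun y ↦ coframe x i y (X y)) x :=
  (smoothCotNear_coframe x i).apply hX

/-- The test form α is known only through its values on vector fields. It is therefore expanded in
the coframe, whose members are smooth sections of the cotangent bundle, and τ is evaluated on those.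
-/
theorem SmoothCon2.near {τ : Π x : M, Con2 n x} (hτ : SmoothCon2 τ) (x : M) :
    SmoothCon2Near τ x := by
  refine Eventually.of_forall fun y α hα ↦ ?_
  have h1 : ∀ i : Fin n, SmoothTanNear (fun z ↦ τ z (coframe y i z)) y := fun i ↦ by
    obtain ⟨s, hs, h⟩ := FiberBundle.exists_contMDiffOn_extend (k := ∞) (𝓡 n)
      (EuclideanSpace ℝ (Fin n) →L[ℝ] ℝ) (cotBasis y i)
    filter_upwards [eventually_mem_nhds_iff.2 hs] with z hz
    exact ContMDiffAt.clm_bundle_apply (hτ z) (h.contMDiffAt hz)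
  refine (SmoothTanNear.sum fun i ↦ .smul (hα.apply (smoothTanNear_frame y i)) (h1 i)).congr ?_
  filter_upwards [coframe_frame (n := n) y] with z hz
  exact con2_apply_eq_sum hz _ _

/-- The right side involves X only through X x: this is the passage from function-linear to
pointwise. -/
theorem TensorialNear.tan_eq_sum {A : Type*} [AddCommGroup A] [Module ℝ A]
    {Φ : (Π x : M, Tan n x) → A} {x : M} (h : TensorialNear n (SmoothTanNear · x) Φ x)
    {X : Π x : M, Tan n x} (hX : SmoothTanNear X x) :
    Φ X = ∑ i, (cotBasis x i (X x) : ℝ) • Φ (frame x i) := by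
  simp only [← coframe_self]
  refine h.eq_sum (.add) (.smul) (smoothTanNear_frame x) hX
    (fun i ↦ SmoothFunNear.coframe hX i) ?_
  filter_upwards [coframe_frame (n := n) x] with y hy
  exact dual_expand hy _

theorem SmoothCon2Near.add {σ τ : Π x : M, Con2 n x} {x : M} (hσ : SmoothCon2Near σ x)
    (hτ : SmoothCon2Near τ x) : SmoothCon2Near (fun y ↦ σ y + τ y) x := by
  filter_upwards [hσ, hτ] with y h1 h2 α hα
  exact (h1 α hα).add (h2 α hα)

theorem SmoothCon2Near.sub {σ τ : Π x : M, Con2 n x} {x : M} (hσ : SmoothCon2Near σ x)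
    (hτ : SmoothCon2Near τ x) : SmoothCon2Near (fun y ↦ σ y - τ y) x := by
  filter_upwards [hσ, hτ] with y h1 h2 α hα
  exact (h1 α hα).sub (h2 α hα)

theorem SmoothCon2Near.smul {f : M → ℝ} {σ : Π x : M, Con2 n x} {x : M}
    (hf : SmoothFunNear n f x) (hσ : SmoothCon2Near σ x) :
    SmoothCon2Near (fun y ↦ f y • σ y) x := by
  filter_upwards [hσ, hf.eventually] with y h1 h2 α hα
  exact .smul h2 (h1 α hα)

theorem SmoothCon2Near.smulRight {X Y : Π x : M, Tan n x} {x : M}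
    (hX : SmoothTanNear X x) (hY : SmoothTanNear Y x) :
    SmoothCon2Near (fun y ↦ (evalCot (X y)).smulRight (Y y)) x := by
  filter_upwards [hX.eventually, hY.eventually] with y h1 h2 α hα
  exact .smul (hα.apply h1) h2

theorem SmoothCon2Near.symProd {X Y : Π x : M, Tan n x} {x : M}
    (hX : SmoothTanNear X x) (hY : SmoothTanNear Y x) :
    SmoothCon2Near (fun y ↦ symProd (X y) (Y y)) x :=
  (SmoothCon2Near.smulRight hX hY).add (SmoothCon2Near.smulRight hY hX)

/-- The local frame `e_i ⊗ e_j` of contravariant 2-tensors. -/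
def frame2 (x : M) (p : Fin n × Fin n) (y : M) : Con2 n y :=
  (evalCot (frame x p.2 y)).smulRight (frame x p.1 y)

theorem smoothCon2Near_frame2 (x : M) (p : Fin n × Fin n) : SmoothCon2Near (frame2 x p) x :=
  .smulRight (smoothTanNear_frame x _) (smoothTanNear_frame x _)

theorem TensorialNear.con2_eq_sum {A : Type*} [AddCommGroup A] [Module ℝ A]
    {Φ : (Π x : M, Con2 n x) → A} {x : M} (h : TensorialNear n (SmoothCon2Near · x) Φ x)
    {τ : Π x : M, Con2 n x} (hτ : SmoothCon2Near τ x) :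
    Φ τ = ∑ p : Fin n × Fin n,
      (cotBasis x p.1 (τ x (cotBasis x p.2)) : ℝ) • Φ (frame2 x p) := by
  simp only [← coframe_self]
  refine h.eq_sum (.add) (.smul) (smoothCon2Near_frame2 x) hτ
    (fun p ↦ SmoothFunNear.coframe (hτ.apply (smoothCotNear_coframe x _)) _) ?_
  filter_upwards [coframe_frame (n := n) x] with y hy
  exact ProjProlong.con2_eq_sum hy _

end

/-! ### Connections, differentials and Lie brackets acting on germs. -/

section

variable {n : ℕ} {M : Type*} [TopologicalSpace M] [ChartedSpace (EuclideanSpace ℝ (Fin n)) M]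

/-! ### Differentials of functions and covariant derivatives of vector fields -/

section dFun

variable {f g : M → ℝ} {x : M} (u : Tan n x)

theorem dFun_add (hf : SmoothFunNear n f x) (hg : SmoothFunNear n g x) :
    dFun (fun y ↦ f y + g y) x u = dFun f x u + dFun g x u :=
  congrArg (fun L ↦ L u) (mvfderiv_add hf.mdiff hg.mdiff)

theorem dFun_sub (hf : SmoothFunNear n f x) (hg : SmoothFunNear n g x) :
    dFun (fun y ↦ f y - g y) x u = dFun f x u - dFun g x u :=
  congrArg (fun L ↦ L u) (mvfderiv_sub hf.mdiff hg.mdiff)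

theorem dFun_mul (hf : SmoothFunNear n f x) (hg : SmoothFunNear n g x) :
    dFun (fun y ↦ f y * g y) x u = f x * dFun g x u + g x * dFun f x u :=
  congrArg (fun L ↦ L u) (mvfderiv_mul hf.mdiff hg.mdiff)

theorem dFun_const (c : ℝ) : dFun (fun _ : M ↦ c) x u = 0 :=
  congrArg (fun L ↦ L u) (mvfderiv_const (I := 𝓡 n) c (x := x))

theorem dFun_congr (h : ∀ᶠ y in 𝓝 x, f y = g y) : dFun f x u = dFun g x u := by
  have := EventuallyEq.mfderiv_eq (I := 𝓡 n) (I' := 𝓘(ℝ, ℝ)) h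
  exact congrArg (fun L : EuclideanSpace ℝ (Fin n) →L[ℝ] ℝ ↦ L u) this

theorem dFun_add_right (v : Tan n x) : dFun f x (u + v) = dFun f x u + dFun f x v := by
  simp [dFun]

theorem dFun_smul_right (c : ℝ) : dFun f x (c • u) = c * dFun f x u := by
  simp [dFun]

end dFun

variable [IsManifold (𝓡 n) ∞ M] (D : Conn n M)

section nabla

variable {X Y : Π x : M, Tan n x} {f : M → ℝ} {x : M} (u : Tan n x)

theorem nabla_add (hX : SmoothTanNear X x) (hY : SmoothTanNear Y x) :
    D (fun y ↦ X y + Y y) x u = D X x u + D Y x u :=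
  congrArg (fun L ↦ L u) (D.isCovariantDerivativeOnUniv.add hX.mdiff hY.mdiff)

theorem nabla_smul (hf : SmoothFunNear n f x) (hX : SmoothTanNear X x) :
    D (fun y ↦ f y • X y) x u = f x • D X x u + dFun f x u • X x :=
  congrArg (fun L ↦ L u) (D.isCovariantDerivativeOnUniv.leibniz hX.mdiff hf.mdiff)

theorem nabla_sub (hX : SmoothTanNear X x) (hY : SmoothTanNear Y x) :
    D (fun y ↦ X y - Y y) x u = D X x u - D Y x u := by
  have h := nabla_smul D u (smoothFunNear_const (-1) x) hY
  have h' := nabla_add D u hX (SmoothTanNear.smul (smoothFunNear_const (-1) x) hY)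
  rw [h, dFun_const] at h'
  simpa [sub_eq_add_neg] using h'

theorem nabla_congr (hX : SmoothTanNear X x) (h : ∀ᶠ y in 𝓝 x, Y y = X y) :
    D Y x u = D X x u :=
  congrArg (fun L ↦ L u) (D.isCovariantDerivativeOnUniv.congr_of_eventuallyEq
    (hX.congr h).mdiff hX.mdiff univ_mem h)

theorem nabla_sum {ι : Type*} [Fintype ι] {X : ι → Π x : M, Tan n x}
    (hX : ∀ i, SmoothTanNear (X i) x) :
    D (fun y ↦ ∑ i, X i y) x u = ∑ i, D (X i) x u := by
  classical
  have key : ∀ s : Finset ι, SmoothTanNear (fun y ↦ ∑ i ∈ s, X i y) x ∧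
      D (fun y ↦ ∑ i ∈ s, X i y) x u = ∑ i ∈ s, D (X i) x u := by
    intro s
    induction s using Finset.induction_on with
    | empty =>
      have h0 : SmoothTanNear (fun y : M ↦ (0 : Tan n y)) x :=
        SmoothTanNear.sum (ι := Empty) (X := fun i ↦ i.elim) fun i ↦ i.elim
      have := nabla_smul D u (smoothFunNear_const 0 x) h0
      rw [dFun_const] at this
      simpa using ⟨h0, by simpa using this⟩
    | insert a s ha ih =>
      simp only [Finset.sum_insert ha]
      exact ⟨(hX a).add ih.1, by rw [nabla_add D u (hX a) ih.1, ih.2]⟩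
  exact (key Finset.univ).2

end nabla

/-- The torsion-free smooth connections on a manifold of positive dimension. -/
structure IsTorsionFreeSmooth : Prop where
  smooth : CovariantDerivative.ContMDiffCovariantDerivative D ∞
  torsion : D.torsion = 0
  dim_pos : 0 < n

variable {D}

/-- Smoothness of D is a statement about global sections. Multiplying by a bump function supported
where X is smooth makes it applicable to germs; the Hausdorff property makes the bump function
smooth on all of M. -/
theorem SmoothTanNear.exists_smoothTan [T2Space M] {X : Π x : M, Tan n x} {x : M}
    (hX : SmoothTanNear X x) : ∃ Y, SmoothTan Y ∧ ∀ᶠ y in 𝓝 x, X y = Y y := by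
  obtain ⟨U, hU, hUo, hxU⟩ := eventually_nhds_iff.1 hX
  obtain ⟨ψ, -, hψ⟩ := (SmoothBumpFunction.nhds_basis_tsupport (I := 𝓡 n) x).mem_iff.1
    (hUo.mem_nhds hxU)
  refine ⟨fun y ↦ ψ y • X y, ?_, ?_⟩
  · refine ContMDiffOn.smul_section_of_tsupport (u := U) ψ.contMDiff.contMDiffOn hUo hψ ?_
    exact fun y hy ↦ (hU y hy).contMDiffWithinAt
  · filter_upwards [ψ.eventuallyEq_one] with y hy
    rw [hy]
    simp

theorem IsTorsionFreeSmooth.nabla [T2Space M] (hD : IsTorsionFreeSmooth D)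
    {X Y : Π x : M, Tan n x} {x : M}
    (hX : SmoothTanNear X x) (hY : SmoothTanNear Y x) :
    SmoothTanNear (fun y ↦ D Y y (X y)) x := by
  obtain ⟨Z, hZ, hYZ⟩ := hY.exists_smoothTan
  have h1 := hD.smooth.contMDiff.contMDiff (σ := Z) (by
    rw [contMDiffOn_univ]
    exact hZ)
  rw [contMDiffOn_univ] at h1
  have h2 : SmoothTanNear (fun y ↦ D Z y (X y)) x := by
    filter_upwards [hX] with y hy
    exact ContMDiffAt.clm_bundle_apply (h1 y) hy
  refine h2.congr ?_
  filter_upwards [hYZ.eventually_nhds] with y hy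
  exact nabla_congr D (X y) (hZ.near y) hy

theorem IsTorsionFreeSmooth.bracket_apply (hD : IsTorsionFreeSmooth D)
    {X Y : Π x : M, Tan n x} {x : M} (hX : SmoothTanNear X x) (hY : SmoothTanNear Y x) :
    VectorField.mlieBracket (𝓡 n) X Y x = D Y x (X x) - D X x (Y x) :=
  ((CovariantDerivative.torsion_eq_zero_iff D).1 hD.torsion hX.mdiff hY.mdiff).symm

theorem IsTorsionFreeSmooth.bracket [T2Space M] (hD : IsTorsionFreeSmooth D)
    {X Y : Π x : M, Tan n x} {x : M} (hX : SmoothTanNear X x) (hY : SmoothTanNear Y x) :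
    SmoothTanNear (VectorField.mlieBracket (𝓡 n) X Y) x := by
  refine ((hD.nabla hX hY).sub (hD.nabla hY hX)).congr ?_
  filter_upwards [hX.eventually, hY.eventually] with y h1 h2
  exact hD.bracket_apply h1 h2

/-- By the Leibniz rule ∇_X(fZ) - f ∇_X Z = df(X) Z, and df(X) is read off with the coframe when Z
is a frame field. Positive dimension provides such a Z. -/
theorem IsTorsionFreeSmooth.dFun [T2Space M] (hD : IsTorsionFreeSmooth D) {f : M → ℝ}
    {X : Π x : M, Tan n x} {x : M} (hf : SmoothFunNear n f x) (hX : SmoothTanNear X x) :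
    SmoothFunNear n (fun y ↦ dFun f y (X y)) x := by
  have hZ := smoothTanNear_frame x (⟨0, hD.dim_pos⟩ : Fin n)
  have h := SmoothFunNear.coframe ((hD.nabla hX (.smul hf hZ)).sub (.smul hf (hD.nabla hX hZ)))
    ⟨0, hD.dim_pos⟩
  refine h.congr ?_
  filter_upwards [hf.eventually, hZ.eventually, coframe_frame (n := n) x] with y h1 h2 h3
  rw [nabla_smul D _ h1 h2, add_sub_cancel_left, map_smul, h3]
  simp

/-- The formula [X,Y]f = XYf - YXf follows from the Jacobi identity for X, Y, fZ with Z a frame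
field: expanding by the Leibniz rule and subtracting f times the identity for X, Y, Z leaves the
claim multiplied by Z. -/
theorem IsTorsionFreeSmooth.dFun_bracket [T2Space M] (hD : IsTorsionFreeSmooth D) {f : M → ℝ}
    {X Y : Π x : M, Tan n x} {x : M} (hf : SmoothFunNear n f x) (hX : SmoothTanNear X x)
    (hY : SmoothTanNear Y x) :
    ProjProlong.dFun f x (VectorField.mlieBracket (𝓡 n) X Y x)
      = ProjProlong.dFun (fun y ↦ ProjProlong.dFun f y (Y y)) x (X x)
        - ProjProlong.dFun (fun y ↦ ProjProlong.dFun f y (X y)) x (Y x) := by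
  have h2 : minSmoothness ℝ 2 ≤ (∞ : WithTop ℕ∞) := by
    rw [minSmoothness_of_isRCLikeNormedField]
    exact WithTop.coe_le_coe.2 (le_top (a := (2 : ℕ∞)))
  have h3 : minSmoothness ℝ 3 ≤ (∞ : WithTop ℕ∞) := by
    rw [minSmoothness_of_isRCLikeNormedField]
    exact WithTop.coe_le_coe.2 (le_top (a := (3 : ℕ∞)))
  have : IsManifold (𝓡 n) (minSmoothness ℝ 3) M := IsManifold.of_le h3
  set i : Fin n := ⟨0, hD.dim_pos⟩
  have hZ := smoothTanNear_frame x i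
  set Z := frame x i with hZdef
  have br : ∀ {W : Π x : M, Tan n x} {y}, SmoothTanNear Z y → SmoothFunNear n f y →
      VectorField.mlieBracket (𝓡 n) W (fun z ↦ f z • Z z) y
        = ProjProlong.dFun f y (W y) • Z y + f y • VectorField.mlieBracket (𝓡 n) W Z y :=
    fun h1 h2 ↦ VectorField.mlieBracket_smul_right h2.mdiff h1.mdiff
  have br2 : ∀ {W V : Π x : M, Tan n x}, SmoothTanNear W x → SmoothTanNear V x →
      VectorField.mlieBracket (𝓡 n) V
        (VectorField.mlieBracket (𝓡 n) W (fun z ↦ f z • Z z)) x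
      = ProjProlong.dFun f x (W x) • VectorField.mlieBracket (𝓡 n) V Z x
        + ProjProlong.dFun (fun y ↦ ProjProlong.dFun f y (W y)) x (V x) • Z x
        + f x • VectorField.mlieBracket (𝓡 n) V (VectorField.mlieBracket (𝓡 n) W Z) x
        + ProjProlong.dFun f x (V x) • VectorField.mlieBracket (𝓡 n) W Z x := fun {W V} hW hV ↦ by
    have hev : VectorField.mlieBracket (𝓡 n) W (fun z ↦ f z • Z z) =ᶠ[𝓝 x]
        (fun y ↦ ProjProlong.dFun f y (W y)) • Z + f • VectorField.mlieBracket (𝓡 n) W Z := by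
      filter_upwards [hf.eventually, hZ.eventually] with y h1 h2
      exact br h2 h1
    have s1 := hD.dFun hf hW
    have s2 := hD.bracket hW hZ
    rw [EventuallyEq.mlieBracket_vectorField_eq (EventuallyEq.refl _ V) hev,
      VectorField.mlieBracket_add_right (W := (fun y ↦ ProjProlong.dFun f y (W y)) • Z)
        (W₁ := f • VectorField.mlieBracket (𝓡 n) W Z) (SmoothTanNear.smul s1 hZ).mdiff
        (SmoothTanNear.smul hf s2).mdiff,
      VectorField.mlieBracket_smul_right s1.mdiff hZ.mdiff,
      VectorField.mlieBracket_smul_right hf.mdiff s2.mdiff]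
    simp only [ProjProlong.dFun]
    abel
  have key := VectorField.leibniz_identity_mlieBracket_apply (I := 𝓡 n) (U := X) (V := Y)
    (W := fun z ↦ f z • Z z) (x := x) (hX.self_of_nhds.of_le h2)
    (hY.self_of_nhds.of_le h2) ((SmoothTanNear.smul hf hZ).self_of_nhds.of_le h2)
  have key' := VectorField.leibniz_identity_mlieBracket_apply (I := 𝓡 n) (U := X) (V := Y)
    (W := Z) (x := x) (hX.self_of_nhds.of_le h2)
    (hY.self_of_nhds.of_le h2) (hZ.self_of_nhds.of_le h2)
  -- The mixed terms (Xf)[Y,Z] and (Yf)[X,Z] occur on both sides, so only multiples of Z x differ;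
  -- pairing with the dual covector extracts the coefficient.
  rw [br2 hY hX, br2 hX hY, br hZ hf, key'] at key
  have h := congrArg (cotBasis x i) key
  have hZx : (cotBasis x i (Z x) : ℝ) = 1 := by
    rw [hZdef, frame_self, cotBasis_tanBasis]
    simp
  simp only [map_add, map_smul, smul_eq_mul, hZx] at h
  linarith

end

/-! ### Riemann, Schouten, Weyl and Cotton-York as smooth tensors. -/

section

variable {n : ℕ} {M : Type*} [TopologicalSpace M] [ChartedSpace (EuclideanSpace ℝ (Fin n)) M]

variable [IsManifold (𝓡 n) ∞ M]

/-! ### Tensoriality of the curvature -/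

/-- Linearity is read off from the frame expansion, so linearity of `extTan` itself is not needed.
-/
theorem TensorialNear.isLinearMap {A : Type*} [AddCommGroup A] [Module ℝ A]
    {Φ : (Π x : M, Tan n x) → A} {x : M} (h : TensorialNear n (SmoothTanNear · x) Φ x) :
    IsLinearMap ℝ fun v : Tan n x ↦ Φ (extTan v) := by
  have key : (fun v : Tan n x ↦ Φ (extTan v))
      = fun v ↦ ∑ i, (cotBasis x i v : ℝ) • Φ (frame x i) := by
    funext v
    rw [h.tan_eq_sum (smoothTanNear_extTan v), extTan_self]
  rw [key]
  constructor
  · intro v w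
    simp [add_smul, Finset.sum_add_distrib]
  · intro c v
    simp [mul_smul, Finset.smul_sum]

theorem TensorialNear.tan_pointwise {A : Type*} [AddCommGroup A] [Module ℝ A]
    {Φ : (Π x : M, Tan n x) → A} {x : M} (h : TensorialNear n (SmoothTanNear · x) Φ x)
    {X Y : Π x : M, Tan n x} (hX : SmoothTanNear X x) (hY : SmoothTanNear Y x)
    (hXY : X x = Y x) : Φ X = Φ Y := by
  rw [h.tan_eq_sum hX, h.tan_eq_sum hY, hXY]

variable {D : Conn n M}

theorem curvField_swap (X Y Z : Π x : M, Tan n x) (x : M) :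
    curvField D Y X Z x = -curvField D X Y Z x := by
  simp only [curvField]
  rw [VectorField.mlieBracket_swap_apply, map_neg]
  abel

/-- `(∇_u P)(V, W)` for vector fields `V` and `W`. -/
def covSchoutenField (D : Conn n M) {x : M} (u : Tan n x) (V W : Π x : M, Tan n x) : ℝ :=
  dFun (fun y ↦ schouten D (V y) (W y)) x u
    - schouten D (D V x u) (W x) - schouten D (V x) (D W x u)

theorem covSchouten_eq_field {x : M} (u v w : Tan n x) :
    covSchouten D u v w = covSchoutenField D u (extTan v) (extTan w) := by
  simp only [covSchouten, covSchoutenField, extTan_self]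

variable [T2Space M]

/-- The term df(Y) ∇_X Z from ∇_Y(f ∇_X Z) cancels the one from [fX, Y] = f[X,Y] - df(Y) X. -/
theorem IsTorsionFreeSmooth.curvField_tensorial₁ (hD : IsTorsionFreeSmooth D)
    (Y : Π x : M, Tan n x) {Z : Π x : M, Tan n x} {x : M} (hZ : SmoothTanNear Z x) :
    TensorialNear n (SmoothTanNear · x) (fun X ↦ curvField D X Y Z x) x where
  add {X X'} hX hX' := by
    simp only [curvField, map_add]
    rw [nabla_add D _ (hD.nabla hX hZ) (hD.nabla hX' hZ),
      show VectorField.mlieBracket (𝓡 n) (fun y ↦ X y + X' y) Y x = _ from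
        VectorField.mlieBracket_add_left hX.mdiff hX'.mdiff, map_add]
    abel
  smul {f X} hf hX := by
    simp only [curvField, map_smul]
    rw [nabla_smul D _ hf (hD.nabla hX hZ),
      show VectorField.mlieBracket (𝓡 n) (fun y ↦ f y • X y) Y x = _ from
        VectorField.mlieBracket_smul_left hf.mdiff hX.mdiff, map_add, map_smul, map_smul]
    simp only [ProjProlong.dFun]
    module
  congr {X X'} hX hX' h := by
    simp only [curvField]
    rw [EventuallyEq.mlieBracket_vectorField_eq h (EventuallyEq.refl _ Y), h.self_of_nhds,
      nabla_congr D (X := fun y ↦ D Z y (X' y)) (Y x) (hD.nabla hX' hZ)]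
    filter_upwards [h] with y hy
    rw [hy]

theorem IsTorsionFreeSmooth.curvField_tensorial₂ (hD : IsTorsionFreeSmooth D)
    (X : Π x : M, Tan n x) {Z : Π x : M, Tan n x} {x : M} (hZ : SmoothTanNear Z x) :
    TensorialNear n (SmoothTanNear · x) (fun Y ↦ curvField D X Y Z x) x where
  add {Y Y'} hY hY' := by
    have := (hD.curvField_tensorial₁ X hZ).add hY hY'
    simp only [curvField_swap X] at this
    rw [← neg_inj, this]
    abel
  smul {f Y} hf hY := by
    have := (hD.curvField_tensorial₁ X hZ).smul hf hY
    simp only [curvField_swap X] at this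
    rw [← neg_inj, this, smul_neg]
  congr {Y Y'} hY hY' h := by
    have := (hD.curvField_tensorial₁ X hZ).congr hY hY' h
    simpa only [curvField_swap X, neg_inj] using this

/-- First derivatives of f enter ∇_X ∇_Y (fZ) symmetrically in X and Y, and its second derivatives
cancel by `dFun_bracket`. -/
theorem IsTorsionFreeSmooth.curvField_tensorial₃ (hD : IsTorsionFreeSmooth D)
    {X Y : Π x : M, Tan n x} {x : M} (hX : SmoothTanNear X x) (hY : SmoothTanNear Y x) :
    TensorialNear n (SmoothTanNear · x) (fun Z ↦ curvField D X Y Z x) x where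
  add {Z Z'} hZ hZ' := by
    have key : ∀ {X Y : Π x : M, Tan n x}, SmoothTanNear X x → SmoothTanNear Y x →
        D (fun y ↦ D (fun z ↦ Z z + Z' z) y (Y y)) x (X x)
          = D (fun y ↦ D Z y (Y y)) x (X x) + D (fun y ↦ D Z' y (Y y)) x (X x) := by
      intro X Y hX hY
      rw [← nabla_add D _ (hD.nabla hY hZ) (hD.nabla hY hZ')]
      refine nabla_congr D _ ((hD.nabla hY hZ).add (hD.nabla hY hZ')) ?_
      filter_upwards [hZ.eventually, hZ'.eventually] with y h1 h2
      exact nabla_add D _ h1 h2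
    simp only [curvField]
    rw [key hX hY, key hY hX, nabla_add D _ hZ hZ']
    abel
  smul {f Z} hf hZ := by
    have key : ∀ {X Y : Π x : M, Tan n x}, SmoothTanNear X x → SmoothTanNear Y x →
        D (fun y ↦ D (fun z ↦ f z • Z z) y (Y y)) x (X x)
          = f x • D (fun y ↦ D Z y (Y y)) x (X x) + ProjProlong.dFun f x (X x) • D Z x (Y x)
            + ProjProlong.dFun f x (Y x) • D Z x (X x)
            + ProjProlong.dFun (fun y ↦ ProjProlong.dFun f y (Y y)) x (X x) • Z x := by
      intro X Y hX hY
      have s1 := hD.nabla hY hZ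
      have s2 := hD.dFun hf hY
      rw [nabla_congr D (X := fun y ↦ f y • D Z y (Y y) + ProjProlong.dFun f y (Y y) • Z y) _
        (.add (.smul hf s1) (.smul s2 hZ)), nabla_add D _ (.smul hf s1) (.smul s2 hZ),
        nabla_smul D _ hf s1, nabla_smul D _ s2 hZ]
      · abel
      · filter_upwards [hf.eventually, hZ.eventually] with y h1 h2
        exact nabla_smul D _ h1 h2
    simp only [curvField]
    rw [key hX hY, key hY hX, nabla_smul D _ hf hZ, hD.dFun_bracket hf hX hY]
    module
  congr {Z Z'} hZ hZ' h := by
    have key : ∀ {X Y : Π x : M, Tan n x}, SmoothTanNear X x → SmoothTanNear Y x →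
        D (fun y ↦ D Z y (Y y)) x (X x) = D (fun y ↦ D Z' y (Y y)) x (X x) := by
      intro X Y hX hY
      refine nabla_congr D _ (hD.nabla hY hZ') ?_
      filter_upwards [h.eventually_nhds, hZ'.eventually] with y h1 h2
      exact nabla_congr D _ h2 h1
    simp only [curvField]
    rw [key hX hY, key hY hX, nabla_congr D _ hZ' h]

/-- The chart-constant extensions in `riem` are exchanged for the given fields one slot at a time.
This gives both smoothness of R on fields and the Ricci identity on vector fields. -/
theorem IsTorsionFreeSmooth.curvField_eq (hD : IsTorsionFreeSmooth D)
    {X Y Z : Π x : M, Tan n x} {x : M} (hX : SmoothTanNear X x) (hY : SmoothTanNear Y x)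
    (hZ : SmoothTanNear Z x) : curvField D X Y Z x = riem D (X x) (Y x) (Z x) := by
  have hX' := smoothTanNear_extTan (X x)
  have hY' := smoothTanNear_extTan (Y x)
  have hZ' := smoothTanNear_extTan (Z x)
  rw [riem, (hD.curvField_tensorial₁ Y hZ).tan_pointwise hX hX' (extTan_self _).symm,
    (hD.curvField_tensorial₂ (extTan (X x)) hZ).tan_pointwise hY hY' (extTan_self _).symm,
    (hD.curvField_tensorial₃ hX' hY').tan_pointwise hZ hZ' (extTan_self _).symm]

theorem IsTorsionFreeSmooth.riem_linear₁ (hD : IsTorsionFreeSmooth D) {x : M} (v w : Tan n x) :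
    IsLinearMap ℝ fun u ↦ riem D u v w :=
  (hD.curvField_tensorial₁ (extTan v) (smoothTanNear_extTan w)).isLinearMap

theorem IsTorsionFreeSmooth.riem_linear₂ (hD : IsTorsionFreeSmooth D) {x : M} (u w : Tan n x) :
    IsLinearMap ℝ fun v ↦ riem D u v w :=
  (hD.curvField_tensorial₂ (extTan u) (smoothTanNear_extTan w)).isLinearMap

theorem IsTorsionFreeSmooth.riem_linear₃ (hD : IsTorsionFreeSmooth D) {x : M} (u v : Tan n x) :
    IsLinearMap ℝ fun w ↦ riem D u v w :=
  (hD.curvField_tensorial₃ (smoothTanNear_extTan u) (smoothTanNear_extTan v)).isLinearMap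

theorem IsTorsionFreeSmooth.riem_smooth (hD : IsTorsionFreeSmooth D)
    {X Y Z : Π x : M, Tan n x} {x : M} (hX : SmoothTanNear X x) (hY : SmoothTanNear Y x)
    (hZ : SmoothTanNear Z x) : SmoothTanNear (fun y ↦ riem D (X y) (Y y) (Z y)) x := by
  refine SmoothTanNear.congr (((hD.nabla hX (hD.nabla hY hZ)).sub
    (hD.nabla hY (hD.nabla hX hZ))).sub (hD.nabla (hD.bracket hX hY) hZ)) ?_
  filter_upwards [hX.eventually, hY.eventually, hZ.eventually] with y h1 h2 h3
  exact (hD.curvField_eq h1 h2 h3).symm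

theorem IsTorsionFreeSmooth.schouten_linear₁ (hD : IsTorsionFreeSmooth D) {x : M} (w : Tan n x) :
    IsLinearMap ℝ fun v ↦ schouten D v w := by
  constructor
  · intro v v'
    simp only [schouten, ric, (hD.riem_linear₂ _ w).map_add, map_add, Finset.sum_add_distrib,
      mul_add]
  · intro c v
    simp only [schouten, ric, (hD.riem_linear₂ _ w).map_smul, map_smul, smul_eq_mul,
      ← Finset.mul_sum]
    ring

theorem IsTorsionFreeSmooth.schouten_linear₂ (hD : IsTorsionFreeSmooth D) {x : M} (v : Tan n x) :
    IsLinearMap ℝ fun w ↦ schouten D v w := by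
  constructor
  · intro w w'
    simp only [schouten, ric, (hD.riem_linear₃ _ v).map_add, map_add, Finset.sum_add_distrib,
      mul_add]
  · intro c w
    simp only [schouten, ric, (hD.riem_linear₃ _ v).map_smul, map_smul, smul_eq_mul,
      ← Finset.mul_sum]
    ring

theorem IsTorsionFreeSmooth.weyl_linear₁ (hD : IsTorsionFreeSmooth D) {x : M} (v w : Tan n x) :
    IsLinearMap ℝ fun u ↦ weyl D u v w := by
  constructor
  · intro u u'
    simp only [weyl, (hD.riem_linear₁ v w).map_add, (hD.schouten_linear₁ w).map_add]
    module
  · intro c u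
    simp only [weyl, (hD.riem_linear₁ v w).map_smul, (hD.schouten_linear₁ w).map_smul, smul_eq_mul]
    module

theorem IsTorsionFreeSmooth.weyl_linear₂ (hD : IsTorsionFreeSmooth D) {x : M} (u w : Tan n x) :
    IsLinearMap ℝ fun v ↦ weyl D u v w := by
  constructor
  · intro v v'
    simp only [weyl, (hD.riem_linear₂ u w).map_add, (hD.schouten_linear₁ w).map_add]
    module
  · intro c v
    simp only [weyl, (hD.riem_linear₂ u w).map_smul, (hD.schouten_linear₁ w).map_smul, smul_eq_mul]
    module

theorem IsTorsionFreeSmooth.weyl_linear₃ (hD : IsTorsionFreeSmooth D) {x : M} (u v : Tan n x) :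
    IsLinearMap ℝ fun w ↦ weyl D u v w := by
  constructor
  · intro w w'
    simp only [weyl, (hD.riem_linear₃ u v).map_add, (hD.schouten_linear₂ _).map_add]
    module
  · intro c w
    simp only [weyl, (hD.riem_linear₃ u v).map_smul, (hD.schouten_linear₂ _).map_smul, smul_eq_mul]
    module

/-- The trace at y is taken in `tanBasis y`, which comes from the preferred chart at y and need not
vary continuously with y. `contract_eq` moves it to the frame at x, which is smooth near x. -/
theorem IsTorsionFreeSmooth.schouten_smooth (hD : IsTorsionFreeSmooth D)
    {V W : Π x : M, Tan n x} {x : M} (hV : SmoothTanNear V x) (hW : SmoothTanNear W x) :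
    SmoothFunNear n (fun y ↦ schouten D (V y) (W y)) x := by
  refine .mul (smoothFunNear_const _ x) ((SmoothFunNear.sum fun i ↦ SmoothFunNear.coframe
    (hD.riem_smooth (smoothTanNear_frame x i) hV hW) i).congr ?_)
  filter_upwards [coframe_frame (n := n) x] with y hy
  refine contract_eq (cotBasis_tanBasis y) hy
    (fun v α ↦ (α (riem D v (V y) (W y)) : ℝ)) (fun α ↦ ⟨fun v v' ↦ ?_, fun c v ↦ ?_⟩)
    fun v ↦ ⟨fun _ _ ↦ rfl, fun _ _ ↦ rfl⟩
  · rw [(hD.riem_linear₁ _ _).map_add, map_add]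
  · rw [(hD.riem_linear₁ _ _).map_smul, map_smul]

theorem IsTorsionFreeSmooth.weyl_smooth (hD : IsTorsionFreeSmooth D)
    {X Y Z : Π x : M, Tan n x} {x : M} (hX : SmoothTanNear X x) (hY : SmoothTanNear Y x)
    (hZ : SmoothTanNear Z x) : SmoothTanNear (fun y ↦ weyl D (X y) (Y y) (Z y)) x :=
  ((hD.riem_smooth hX hY hZ).sub (.smul (hD.schouten_smooth hY hZ) hX)).add
    (.smul (hD.schouten_smooth hX hZ) hY)

/-! ### The derivative of the Schouten tensor -/

theorem IsTorsionFreeSmooth.covSchoutenField_tensorial₁ (hD : IsTorsionFreeSmooth D)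
    {x : M} (u : Tan n x) {W : Π x : M, Tan n x} (hW : SmoothTanNear W x) :
    TensorialNear n (SmoothTanNear · x) (fun V ↦ covSchoutenField D u V W) x where
  add {V V'} hV hV' := by
    simp only [covSchoutenField]
    rw [nabla_add D _ hV hV', (hD.schouten_linear₁ _).map_add, (hD.schouten_linear₁ _).map_add]
    simp only [(hD.schouten_linear₁ _).map_add]
    rw [dFun_add _ (hD.schouten_smooth hV hW) (hD.schouten_smooth hV' hW)]
    ring
  smul {f V} hf hV := by
    simp only [covSchoutenField]
    rw [nabla_smul D _ hf hV, (hD.schouten_linear₁ _).map_add, (hD.schouten_linear₁ _).map_smul,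
      (hD.schouten_linear₁ _).map_smul]
    simp only [(hD.schouten_linear₁ _).map_smul, smul_eq_mul]
    rw [dFun_mul _ hf (hD.schouten_smooth hV hW)]
    ring
  congr {V V'} hV hV' h := by
    simp only [covSchoutenField]
    rw [nabla_congr D _ hV' h, h.self_of_nhds,
      dFun_congr (g := fun y ↦ schouten D (V' y) (W y))]
    filter_upwards [h] with y hy
    rw [hy]

theorem IsTorsionFreeSmooth.covSchoutenField_tensorial₂ (hD : IsTorsionFreeSmooth D)
    {x : M} (u : Tan n x) {V : Π x : M, Tan n x} (hV : SmoothTanNear V x) :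
    TensorialNear n (SmoothTanNear · x) (fun W ↦ covSchoutenField D u V W) x where
  add {W W'} hW hW' := by
    simp only [covSchoutenField]
    rw [nabla_add D _ hW hW', (hD.schouten_linear₂ _).map_add, (hD.schouten_linear₂ _).map_add]
    simp only [(hD.schouten_linear₂ _).map_add]
    rw [dFun_add _ (hD.schouten_smooth hV hW) (hD.schouten_smooth hV hW')]
    ring
  smul {f W} hf hW := by
    simp only [covSchoutenField]
    rw [nabla_smul D _ hf hW, (hD.schouten_linear₂ _).map_add, (hD.schouten_linear₂ _).map_smul,
      (hD.schouten_linear₂ _).map_smul]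
    simp only [(hD.schouten_linear₂ _).map_smul, smul_eq_mul]
    rw [dFun_mul _ hf (hD.schouten_smooth hV hW)]
    ring
  congr {W W'} hW hW' h := by
    simp only [covSchoutenField]
    rw [nabla_congr D _ hW' h, h.self_of_nhds,
      dFun_congr (g := fun y ↦ schouten D (V y) (W' y))]
    filter_upwards [h] with y hy
    rw [hy]

/-- The two correction terms cancel the derivatives of coefficients, so the expression is tensorial
in V and W and the extensions in `covSchouten` may be replaced by any fields. -/
theorem IsTorsionFreeSmooth.covSchouten_apply (hD : IsTorsionFreeSmooth D)
    {x : M} (u : Tan n x) {V W : Π x : M, Tan n x} (hV : SmoothTanNear V x)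
    (hW : SmoothTanNear W x) :
    covSchouten D u (V x) (W x) = ProjProlong.dFun (fun y ↦ schouten D (V y) (W y)) x u
      - schouten D (D V x u) (W x) - schouten D (V x) (D W x u) := by
  have hV' := smoothTanNear_extTan (V x)
  have hW' := smoothTanNear_extTan (W x)
  rw [covSchouten_eq_field,
    (hD.covSchoutenField_tensorial₁ u hW').tan_pointwise hV' hV (extTan_self _),
    (hD.covSchoutenField_tensorial₂ u hV).tan_pointwise hW' hW (extTan_self _), covSchoutenField]

theorem IsTorsionFreeSmooth.covSchouten_linear₁ (hD : IsTorsionFreeSmooth D) {x : M}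
    (v w : Tan n x) : IsLinearMap ℝ fun u ↦ covSchouten D u v w := by
  constructor
  · intro u u'
    simp only [covSchouten, map_add, (hD.schouten_linear₁ _).map_add,
      (hD.schouten_linear₂ _).map_add, dFun_add_right]
    ring
  · intro c u
    simp only [covSchouten, map_smul, (hD.schouten_linear₁ _).map_smul,
      (hD.schouten_linear₂ _).map_smul, dFun_smul_right, smul_eq_mul]
    ring

theorem IsTorsionFreeSmooth.covSchouten_linear₂ (hD : IsTorsionFreeSmooth D) {x : M}
    (u w : Tan n x) : IsLinearMap ℝ fun v ↦ covSchouten D u v w := by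
  simp only [covSchouten_eq_field]
  exact (hD.covSchoutenField_tensorial₁ u (smoothTanNear_extTan w)).isLinearMap

theorem IsTorsionFreeSmooth.covSchouten_linear₃ (hD : IsTorsionFreeSmooth D) {x : M}
    (u v : Tan n x) : IsLinearMap ℝ fun w ↦ covSchouten D u v w := by
  simp only [covSchouten_eq_field]
  exact (hD.covSchoutenField_tensorial₂ u (smoothTanNear_extTan v)).isLinearMap

theorem IsTorsionFreeSmooth.covSchouten_smooth (hD : IsTorsionFreeSmooth D)
    {X Y Z : Π x : M, Tan n x} {x : M} (hX : SmoothTanNear X x) (hY : SmoothTanNear Y x)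
    (hZ : SmoothTanNear Z x) : SmoothFunNear n (fun y ↦ covSchouten D (X y) (Y y) (Z y)) x := by
  refine (((hD.dFun (hD.schouten_smooth hY hZ) hX).sub
    (hD.schouten_smooth (hD.nabla hX hY) hZ)).sub
    (hD.schouten_smooth hY (hD.nabla hX hZ))).congr ?_
  filter_upwards [hY.eventually, hZ.eventually] with y h2 h3
  exact hD.covSchouten_apply _ h2 h3

theorem IsTorsionFreeSmooth.cotton_linear₁ (hD : IsTorsionFreeSmooth D) {x : M}
    (v w : Tan n x) : IsLinearMap ℝ fun u ↦ cotton D u v w := by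
  constructor
  · intro u u'
    simp only [cotton, (hD.covSchouten_linear₁ _ _).map_add, (hD.covSchouten_linear₂ _ _).map_add]
    ring
  · intro c u
    simp only [cotton, (hD.covSchouten_linear₁ _ _).map_smul,
      (hD.covSchouten_linear₂ _ _).map_smul, smul_eq_mul]
    ring

theorem IsTorsionFreeSmooth.cotton_linear₂ (hD : IsTorsionFreeSmooth D) {x : M}
    (u w : Tan n x) : IsLinearMap ℝ fun v ↦ cotton D u v w := by
  constructor
  · intro u u'
    simp only [cotton, (hD.covSchouten_linear₁ _ _).map_add, (hD.covSchouten_linear₂ _ _).map_add]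
    ring
  · intro c u
    simp only [cotton, (hD.covSchouten_linear₁ _ _).map_smul,
      (hD.covSchouten_linear₂ _ _).map_smul, smul_eq_mul]
    ring

theorem IsTorsionFreeSmooth.cotton_linear₃ (hD : IsTorsionFreeSmooth D) {x : M}
    (u v : Tan n x) : IsLinearMap ℝ fun w ↦ cotton D u v w := by
  constructor
  · intro u u'
    simp only [cotton, (hD.covSchouten_linear₃ _ _).map_add]
    ring
  · intro c u
    simp only [cotton, (hD.covSchouten_linear₃ _ _).map_smul, smul_eq_mul]
    ring

theorem IsTorsionFreeSmooth.cotton_smooth (hD : IsTorsionFreeSmooth D)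
    {X Y Z : Π x : M, Tan n x} {x : M} (hX : SmoothTanNear X x) (hY : SmoothTanNear Y x)
    (hZ : SmoothTanNear Z x) : SmoothFunNear n (fun y ↦ cotton D (X y) (Y y) (Z y)) x := by
  refine (SmoothFunNear.mul (smoothFunNear_const (1 / 2) x)
    ((hD.covSchouten_smooth hX hY hZ).sub (hD.covSchouten_smooth hY hX hZ))).congr ?_
  filter_upwards with y
  rw [cotton]
  ring

end

/-! ### Induced connections on 1-forms and 2-tensors, and their Ricci identities. -/

section

variable {n : ℕ} {M : Type*} [TopologicalSpace M] [ChartedSpace (EuclideanSpace ℝ (Fin n)) M]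

variable [IsManifold (𝓡 n) ∞ M] {D : Conn n M}

/-! ### Derivatives of 1-forms -/

/-- `covCot` prescribes the Leibniz rule on the frame at x only; the right side is tensorial in V,
so the rule extends to all fields. `covCon2_apply` repeats the argument with 1-forms as test
objects. -/
theorem covCot_apply (D : Conn n M) {x : M} (u : Tan n x) {α : Π x : M, Cot n x}
    {V : Π x : M, Tan n x} (hα : SmoothCotNear α x) (hV : SmoothTanNear V x) :
    (covCot D α x u (V x) : ℝ)
      = dFun (fun y ↦ (α y (V y) : ℝ)) x u - (α x (D V x u) : ℝ) := by
  have h : TensorialNear n (SmoothTanNear · x) (fun V : Π x : M, Tan n x ↦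
      dFun (fun y ↦ (α y (V y) : ℝ)) x u - (α x (D V x u) : ℝ)) x :=
    { add := fun {V W} hV hW ↦ by
        simp only [map_add]
        rw [nabla_add D _ hV hW, dFun_add _ (hα.apply hV) (hα.apply hW), map_add]
        ring
      smul := fun {f V} hf hV ↦ by
        simp only [map_smul, smul_eq_mul]
        rw [nabla_smul D _ hf hV, dFun_mul _ hf (hα.apply hV), map_add, map_smul, map_smul,
          smul_eq_mul, smul_eq_mul]
        ring
      congr := fun {V W} _ hW h ↦ by
        rw [nabla_congr D _ hW h, dFun_congr (g := fun y ↦ (α y (W y) : ℝ))]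
        filter_upwards [h] with y hy
        rw [hy] }
  rw [h.tan_eq_sum hV, covCot, sum_apply]
  refine Finset.sum_congr rfl fun i _ ↦ ?_
  rw [smul_apply, smul_eq_mul, smul_eq_mul, mul_comm]
  rfl

theorem covCot_add (D : Conn n M) {x : M} (u : Tan n x) {α β : Π x : M, Cot n x}
    (hα : SmoothCotNear α x) (hβ : SmoothCotNear β x) (hαβ : SmoothCotNear (fun y ↦ α y + β y) x) :
    covCot D (fun y ↦ α y + β y) x u = covCot D α x u + covCot D β x u := by
  refine ContinuousLinearMap.ext fun v ↦ ?_
  have hv := smoothTanNear_extTan v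
  rw [← extTan_self v, add_apply, covCot_apply D u hα hv, covCot_apply D u hβ hv,
    covCot_apply D u hαβ hv]
  simp only [add_apply]
  rw [dFun_add _ (hα.apply hv) (hβ.apply hv)]
  ring

theorem covCot_smul (D : Conn n M) {x : M} (u : Tan n x) {f : M → ℝ} {α : Π x : M, Cot n x}
    (hf : SmoothFunNear n f x) (hα : SmoothCotNear α x)
    (hfα : SmoothCotNear (fun y ↦ f y • α y) x) :
    covCot D (fun y ↦ f y • α y) x u = f x • covCot D α x u + dFun f x u • α x := by
  refine ContinuousLinearMap.ext fun v ↦ ?_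
  have hv := smoothTanNear_extTan v
  rw [← extTan_self v, add_apply, smul_apply, smul_apply, covCot_apply D u hα hv,
    covCot_apply D u hfα hv]
  simp only [smul_apply, smul_eq_mul]
  rw [dFun_mul _ hf (hα.apply hv)]
  ring

theorem covCot_congr (D : Conn n M) {x : M} (u : Tan n x) {α β : Π x : M, Cot n x}
    (h : ∀ᶠ y in 𝓝 x, α y = β y) : covCot D α x u = covCot D β x u := by
  simp only [covCot]
  refine Finset.sum_congr rfl fun i _ ↦ ?_
  rw [h.self_of_nhds, dFun_congr (g := fun y ↦ (β y (extTan (tanBasis x i) y) : ℝ))]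
  filter_upwards [h] with y hy
  rw [hy]

theorem covCot_add_right (D : Conn n M) (α : Π x : M, Cot n x) {x : M} (u v : Tan n x) :
    covCot D α x (u + v) = covCot D α x u + covCot D α x v := by
  simp only [covCot]
  rw [← Finset.sum_add_distrib]
  refine Finset.sum_congr rfl fun i _ ↦ ?_
  rw [dFun_add_right, map_add, map_add, ← add_smul]
  congr 1
  ring

theorem covCot_smul_right (D : Conn n M) (α : Π x : M, Cot n x) {x : M} (c : ℝ) (u : Tan n x) :
    covCot D α x (c • u) = c • covCot D α x u := by
  simp only [covCot]
  rw [Finset.smul_sum]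
  refine Finset.sum_congr rfl fun i _ ↦ ?_
  rw [dFun_smul_right, map_smul, map_smul, smul_smul]
  congr 1
  rw [smul_eq_mul]
  ring

theorem SmoothCotNear.add {α β : Π x : M, Cot n x} {x : M} (hα : SmoothCotNear α x)
    (hβ : SmoothCotNear β x) : SmoothCotNear (fun y ↦ α y + β y) x := by
  filter_upwards [hα, hβ] with y h1 h2 X hX
  exact (h1 X hX).add (h2 X hX)

theorem SmoothCotNear.smul {f : M → ℝ} {α : Π x : M, Cot n x} {x : M}
    (hf : SmoothFunNear n f x) (hα : SmoothCotNear α x) :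
    SmoothCotNear (fun y ↦ f y • α y) x := by
  filter_upwards [hα, hf.eventually] with y h1 h2 X hX
  exact h2.mul (h1 X hX)

theorem TensorialNear.cot_eq_sum {A : Type*} [AddCommGroup A] [Module ℝ A]
    {Φ : (Π x : M, Cot n x) → A} {x : M} (h : TensorialNear n (SmoothCotNear · x) Φ x)
    {α : Π x : M, Cot n x} (hα : SmoothCotNear α x) :
    Φ α = ∑ i, (α x (tanBasis x i) : ℝ) • Φ (coframe x i) := by
  simp only [← frame_self]
  refine h.eq_sum (.add) (.smul) (smoothCotNear_coframe x) hα
    (fun i ↦ hα.apply (smoothTanNear_frame x i)) ?_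
  filter_upwards [coframe_frame (n := n) x] with y hy
  exact dual_expand_cot hy _

/-! ### Derivatives of contravariant 2-tensors -/

theorem covCon2_apply (D : Conn n M) {x : M} (u : Tan n x) {τ : Π x : M, Con2 n x}
    {α : Π x : M, Cot n x} (hτ : SmoothCon2Near τ x) (hα : SmoothCotNear α x) :
    covCon2 D τ x u (α x) = D (fun y ↦ τ y (α y)) x u - τ x (covCot D α x u) := by
  have h : TensorialNear n (SmoothCotNear · x) (fun α : Π x : M, Cot n x ↦
      D (fun y ↦ τ y (α y)) x u - τ x (covCot D α x u)) x :=
    { add := fun {α β} hα hβ ↦ by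
        simp only [map_add]
        rw [nabla_add D _ (hτ.apply hα) (hτ.apply hβ), covCot_add D u hα hβ (hα.add hβ), map_add]
        abel
      smul := fun {f α} hf hα ↦ by
        simp only [map_smul]
        rw [nabla_smul D _ hf (hτ.apply hα), covCot_smul D u hf hα (.smul hf hα), map_add,
          map_smul, map_smul]
        module
      congr := fun {α β} _ hβ h ↦ by
        rw [covCot_congr D _ h, nabla_congr D (X := fun y ↦ τ y (β y)) _ (hτ.apply hβ)]
        filter_upwards [h] with y hy
        rw [hy] }
  rw [h.cot_eq_sum hα, covCon2, sum_apply]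
  exact Finset.sum_congr rfl fun i _ ↦ rfl

theorem covCon2_add (D : Conn n M) {x : M} (u : Tan n x) {σ τ : Π x : M, Con2 n x}
    (hσ : SmoothCon2Near σ x) (hτ : SmoothCon2Near τ x) :
    covCon2 D (fun y ↦ σ y + τ y) x u = covCon2 D σ x u + covCon2 D τ x u := by
  refine ContinuousLinearMap.ext fun α ↦ ?_
  have hα := smoothCotNear_extCot α
  rw [← extCot_self α, add_apply, covCon2_apply D u hσ hα, covCon2_apply D u hτ hα,
    covCon2_apply D u (hσ.add hτ) hα]
  simp only [add_apply]
  rw [nabla_add D _ (hσ.apply hα) (hτ.apply hα)]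
  abel

theorem covCon2_sub (D : Conn n M) {x : M} (u : Tan n x) {σ τ : Π x : M, Con2 n x}
    (hσ : SmoothCon2Near σ x) (hτ : SmoothCon2Near τ x) :
    covCon2 D (fun y ↦ σ y - τ y) x u = covCon2 D σ x u - covCon2 D τ x u := by
  refine ContinuousLinearMap.ext fun α ↦ ?_
  have hα := smoothCotNear_extCot α
  rw [← extCot_self α, sub_apply, covCon2_apply D u hσ hα, covCon2_apply D u hτ hα,
    covCon2_apply D u (hσ.sub hτ) hα]
  simp only [sub_apply]
  rw [nabla_sub D _ (hσ.apply hα) (hτ.apply hα)]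
  abel

theorem covCon2_smul (D : Conn n M) {x : M} (u : Tan n x) {f : M → ℝ} {τ : Π x : M, Con2 n x}
    (hf : SmoothFunNear n f x) (hτ : SmoothCon2Near τ x) :
    covCon2 D (fun y ↦ f y • τ y) x u = f x • covCon2 D τ x u + dFun f x u • τ x := by
  refine ContinuousLinearMap.ext fun α ↦ ?_
  have hα := smoothCotNear_extCot α
  rw [← extCot_self α, add_apply, smul_apply, smul_apply, covCon2_apply D u hτ hα,
    covCon2_apply D u (.smul hf hτ) hα]
  simp only [smul_apply]
  rw [nabla_smul D _ hf (hτ.apply hα)]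
  module

theorem covCon2_congr (D : Conn n M) {x : M} (u : Tan n x) {σ τ : Π x : M, Con2 n x}
    (hτ : SmoothCon2Near τ x) (h : ∀ᶠ y in 𝓝 x, σ y = τ y) :
    covCon2 D σ x u = covCon2 D τ x u := by
  simp only [covCon2]
  refine Finset.sum_congr rfl fun i _ ↦ ?_
  rw [h.self_of_nhds, nabla_congr D (X := fun y ↦ τ y (extCot (cotBasis x i) y)) _
    (hτ.apply (smoothCotNear_extCot _))]
  filter_upwards [h] with y hy
  rw [hy]

theorem covCon2_add_right (D : Conn n M) (τ : Π x : M, Con2 n x) {x : M} (u v : Tan n x) :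
    covCon2 D τ x (u + v) = covCon2 D τ x u + covCon2 D τ x v := by
  refine ContinuousLinearMap.ext fun α ↦ ?_
  simp only [covCon2, add_apply, sum_apply, ← Finset.sum_add_distrib]
  refine Finset.sum_congr rfl fun i _ ↦ ?_
  simp only [ContinuousLinearMap.smulRight_apply, covCot_add_right, map_add]
  module

theorem covCon2_smul_right (D : Conn n M) (τ : Π x : M, Con2 n x) {x : M} (c : ℝ) (u : Tan n x) :
    covCon2 D τ x (c • u) = c • covCon2 D τ x u := by
  refine ContinuousLinearMap.ext fun α ↦ ?_
  simp only [covCon2, smul_apply, sum_apply, Finset.smul_sum]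
  refine Finset.sum_congr rfl fun i _ ↦ ?_
  simp only [ContinuousLinearMap.smulRight_apply, covCot_smul_right, map_smul]
  module

theorem covCon2_symProd (D : Conn n M) {x : M} (u : Tan n x) {V W : Π x : M, Tan n x}
    (hV : SmoothTanNear V x) (hW : SmoothTanNear W x) :
    covCon2 D (fun y ↦ symProd (V y) (W y)) x u
      = symProd (D V x u) (W x) + symProd (V x) (D W x u) := by
  refine ContinuousLinearMap.ext fun α ↦ ?_
  have hα := smoothCotNear_extCot α
  have e : ∀ {y : M} (v w : Tan n y) (α : Cot n y),
      symProd v w α = (α v : ℝ) • w + (α w : ℝ) • v := fun _ _ _ ↦ rfl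
  rw [← extCot_self α, covCon2_apply D u (.symProd hV hW) hα, add_apply]
  simp only [e]
  rw [nabla_add D _ (.smul (hα.apply hV) hW) (.smul (hα.apply hW) hV),
    nabla_smul D _ (hα.apply hV) hW, nabla_smul D _ (hα.apply hW) hV,
    covCot_apply D u hα hV, covCot_apply D u hα hW]
  module

variable [T2Space M]

theorem IsTorsionFreeSmooth.covCot (hD : IsTorsionFreeSmooth D) {α : Π x : M, Cot n x}
    {Y : Π x : M, Tan n x} {x : M} (hα : SmoothCotNear α x) (hY : SmoothTanNear Y x) :
    SmoothCotNear (fun y ↦ covCot D α y (Y y)) x := by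
  filter_upwards [hα.eventually, hY.eventually] with y h1 h2 V hV
  refine ((hD.dFun (h1.apply hV) h2).sub (h1.apply (hD.nabla h2 hV))).congr ?_
  filter_upwards [h1.eventually, hV.eventually] with z h3 h4
  exact covCot_apply D _ h3 h4

theorem IsTorsionFreeSmooth.covCon2 (hD : IsTorsionFreeSmooth D) {τ : Π x : M, Con2 n x}
    {Y : Π x : M, Tan n x} {x : M} (hτ : SmoothCon2Near τ x) (hY : SmoothTanNear Y x) :
    SmoothCon2Near (fun y ↦ covCon2 D τ y (Y y)) x := by
  filter_upwards [hτ.eventually, hY.eventually] with y h1 h2 α hα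
  refine ((hD.nabla h2 (h1.apply hα)).sub (h1.apply (hD.covCot hα h2))).congr ?_
  filter_upwards [h1.eventually, hα.eventually] with z h3 h4
  exact covCon2_apply D _ h3 h4

/-! ### Ricci identities -/

/-- Two uses of the Leibniz rule write (∇_X ∇_Y α)(V) as XY(α(V)) + α(∇_Y ∇_X V) minus terms
symmetric in X and Y. Skewing gives minus the curvature on V, since the derivatives of α(V) along X,
Y and [X,Y] cancel by `dFun_bracket`. -/
theorem IsTorsionFreeSmooth.ricci_cot (hD : IsTorsionFreeSmooth D) {α : Π x : M, Cot n x}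
    {X Y : Π x : M, Tan n x} {x : M} (hα : SmoothCotNear α x) (hX : SmoothTanNear X x)
    (hY : SmoothTanNear Y x) :
    ProjProlong.covCot D (fun y ↦ ProjProlong.covCot D α y (Y y)) x (X x)
      - ProjProlong.covCot D (fun y ↦ ProjProlong.covCot D α y (X y)) x (Y x)
      - ProjProlong.covCot D α x (VectorField.mlieBracket (𝓡 n) X Y x)
      = -∑ i, (α x (riem D (X x) (Y x) (tanBasis x i)) : ℝ) • cotBasis x i := by
  have key : ∀ {X Y V : Π x : M, Tan n x}, SmoothTanNear X x → SmoothTanNear Y x →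
      SmoothTanNear V x →
      (ProjProlong.covCot D (fun y ↦ ProjProlong.covCot D α y (Y y)) x (X x) (V x) : ℝ)
        = ProjProlong.dFun (fun y ↦ ProjProlong.dFun (fun z ↦ (α z (V z) : ℝ)) y (Y y)) x (X x)
          - ProjProlong.dFun (fun y ↦ (α y (D V y (Y y)) : ℝ)) x (X x)
          - (ProjProlong.dFun (fun y ↦ (α y (D V y (X y)) : ℝ)) x (Y x)
            - (α x (D (fun y ↦ D V y (X y)) x (Y x)) : ℝ)) := by
    intro X Y V hX hY hV
    rw [covCot_apply D _ (hD.covCot hα hY) hV,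
      ← covCot_apply D (Y x) hα (hD.nabla hX hV),
      ← dFun_sub _ (hD.dFun (hα.apply hV) hY) (hα.apply (hD.nabla hY hV))]
    congr 1
    refine dFun_congr _ ?_
    filter_upwards [hα.eventually, hV.eventually] with y h1 h2
    exact covCot_apply D _ h1 h2
  refine ContinuousLinearMap.ext fun v ↦ ?_
  have hV := smoothTanNear_extTan v
  have hr : (α x (riem D (X x) (Y x) v) : ℝ)
      = (∑ i, (α x (riem D (X x) (Y x) (tanBasis x i)) : ℝ) • cotBasis x i) v := by
    conv_lhs => rw [dual_expand (cotBasis_tanBasis x) v]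
    rw [← (hD.riem_linear₃ _ _).mk'_apply, map_sum, map_sum, sum_apply]
    refine Finset.sum_congr rfl fun i _ ↦ ?_
    simp only [map_smul, smul_eq_mul, smul_apply, IsLinearMap.mk'_apply]
    rw [mul_comm]
  rw [neg_apply, ← hr]
  have h3 : riem D (X x) (Y x) v = curvField D X Y (extTan v) x := by
    rw [hD.curvField_eq hX hY hV, extTan_self]
  rw [h3, ← extTan_self v, sub_apply, sub_apply, key hX hY hV, key hY hX hV,
    covCot_apply D _ hα hV, hD.dFun_bracket (hα.apply hV) hX hY]
  simp only [curvField, map_sub, extTan_self]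
  ring

/-- The same computation for τ(α): the curvature of the vector field τ(α) minus τ of the curvature
of α, the latter supplied by `ricci_cot` with its own minus sign. -/
theorem IsTorsionFreeSmooth.ricci_con2 (hD : IsTorsionFreeSmooth D) {τ : Π x : M, Con2 n x}
    {X Y : Π x : M, Tan n x} {x : M} (hτ : SmoothCon2Near τ x) (hX : SmoothTanNear X x)
    (hY : SmoothTanNear Y x) (α : Cot n x) :
    (ProjProlong.covCon2 D (fun y ↦ ProjProlong.covCon2 D τ y (Y y)) x (X x)
      - ProjProlong.covCon2 D (fun y ↦ ProjProlong.covCon2 D τ y (X y)) x (Y x)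
      - ProjProlong.covCon2 D τ x (VectorField.mlieBracket (𝓡 n) X Y x)) α
      = riem D (X x) (Y x) (τ x α)
        + ∑ i, (α (riem D (X x) (Y x) (tanBasis x i)) : ℝ) • τ x (cotBasis x i) := by
  have hα := smoothCotNear_extCot α
  have key : ∀ {X Y : Π x : M, Tan n x}, SmoothTanNear X x → SmoothTanNear Y x →
      ProjProlong.covCon2 D (fun y ↦ ProjProlong.covCon2 D τ y (Y y)) x (X x) (extCot α x)
        = D (fun y ↦ D (fun z ↦ τ z (extCot α z)) y (Y y)) x (X x)
          - D (fun y ↦ τ y (ProjProlong.covCot D (extCot α) y (Y y))) x (X x)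
          - (D (fun y ↦ τ y (ProjProlong.covCot D (extCot α) y (X y))) x (Y x)
            - τ x (ProjProlong.covCot D (fun y ↦ ProjProlong.covCot D (extCot α) y (X y)) x
              (Y x))) := by
    intro X Y hX hY
    have s1 := hD.nabla hY (hτ.apply hα)
    have s2 := hτ.apply (hD.covCot hα hY)
    rw [covCon2_apply D _ (hD.covCon2 hτ hY) hα,
      ← covCon2_apply D (Y x) hτ (hD.covCot hα hX), ← nabla_sub D _ s1 s2]
    congr 1
    refine nabla_congr D _ (s1.sub s2) ?_
    filter_upwards [hτ.eventually, hα.eventually] with y h1 h2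
    exact covCon2_apply D _ h1 h2
  have h4 := congrArg (τ x) (hD.ricci_cot hα hX hY)
  rw [map_sub, map_sub, map_neg, map_sum] at h4
  simp only [map_smul] at h4
  have h5 := hD.curvField_eq hX hY (hτ.apply hα)
  rw [extCot_self] at h5 h4
  have h6 : extCot α x = α := extCot_self α
  rw [sub_apply, sub_apply, ← h5]
  -- Each replacement leaves an α inside `extCot α x`, so the argument of the next derivative term
  -- is one occurrence further on.
  nth_rw 1 [← h6]
  nth_rw 2 [← h6]
  nth_rw 3 [← h6]
  rw [key hX hY, key hY hX, covCon2_apply D _ hτ hα, ← neg_eq_iff_eq_neg.2 h4]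
  simp only [curvField]
  abel

end

/-! ### Contractions of P, W and Y with σ, and their covariant derivatives. -/

section

variable {n : ℕ} {M : Type*} [TopologicalSpace M] [ChartedSpace (EuclideanSpace ℝ (Fin n)) M]

theorem symProd_apply {x : M} (v w : Tan n x) (α : Cot n x) :
    symProd v w α = (α v : ℝ) • w + (α w : ℝ) • v := rfl

theorem symProd_linear₁ {x : M} (w : Tan n x) : IsLinearMap ℝ fun v ↦ symProd v w := by
  constructor
  · intro v v'
    refine ContinuousLinearMap.ext fun α ↦ ?_
    simp only [symProd_apply, add_apply, map_add]
    module
  · intro c v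
    refine ContinuousLinearMap.ext fun α ↦ ?_
    simp only [symProd_apply, smul_apply, map_smul, smul_eq_mul]
    module

theorem symProd_sub_left {x : M} (v v' w : Tan n x) :
    symProd (v - v') w = symProd v w - symProd v' w := by
  refine ContinuousLinearMap.ext fun α ↦ ?_
  simp only [symProd_apply, sub_apply, map_sub]
  module

theorem symProd_comm {x : M} (v w : Tan n x) : symProd v w = symProd w v := by
  refine ContinuousLinearMap.ext fun α ↦ ?_
  simp only [symProd_apply]
  abel

theorem symProd_linear₂ {x : M} (v : Tan n x) : IsLinearMap ℝ fun w ↦ symProd v w := by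
  simp only [symProd_comm v]
  exact symProd_linear₁ v

variable [IsManifold (𝓡 n) ∞ M] {D : Conn n M}

/-- The pairings of coframe and frame are constant near x, so the connection coefficients of the
coframe are minus those of the frame, transposed. -/
theorem covCot_coframe (D : Conn n M) (x : M) (u : Tan n x) (i : Fin n) :
    covCot D (coframe x i) x u = -∑ j, (cotBasis x i (D (frame x j) x u) : ℝ) • cotBasis x j := by
  rw [dual_expand_cot (cotBasis_tanBasis x) (covCot D (coframe x i) x u), ← Finset.sum_neg_distrib]
  refine Finset.sum_congr rfl fun j _ ↦ ?_
  rw [← frame_self, covCot_apply D u (smoothCotNear_coframe x i) (smoothTanNear_frame x j),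
    dFun_congr (g := fun _ ↦ if i = j then 1 else 0), dFun_const, coframe_self, zero_sub]
  · exact neg_smul (R := ℝ) (M := Cot n x) _ _
  · filter_upwards [coframe_frame (n := n) x] with y hy
    exact hy i j

theorem schoutenCon_linear₂ (D : Conn n M) {x : M} (u : Tan n x) :
    IsLinearMap ℝ fun τ ↦ schoutenCon D u τ := by
  constructor
  · intro σ τ
    simp only [schoutenCon, add_apply, smul_add, Finset.sum_add_distrib]
  · intro c τ
    simp only [schoutenCon, smul_apply, Finset.smul_sum, smul_comm c]

variable [T2Space M]

/-! ### Contractions with `σ^{bc}` -/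

section contractions

variable {x : M}

theorem IsTorsionFreeSmooth.schoutenCon_linear₁ (hD : IsTorsionFreeSmooth D) (τ : Con2 n x) :
    IsLinearMap ℝ fun u ↦ schoutenCon D u τ := by
  constructor
  · intro u v
    simp only [schoutenCon, (hD.schouten_linear₁ _).map_add, add_smul, Finset.sum_add_distrib]
  · intro c u
    simp only [schoutenCon, (hD.schouten_linear₁ _).map_smul, smul_assoc, Finset.smul_sum]

theorem IsTorsionFreeSmooth.weylCon_linear₁ (hD : IsTorsionFreeSmooth D) (τ : Con2 n x) :
    IsLinearMap ℝ fun u ↦ weylCon D u τ := by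
  constructor
  · intro u v
    simp only [weylCon, (hD.weyl_linear₁ _ _).map_add, Finset.sum_add_distrib]
  · intro c u
    simp only [weylCon, (hD.weyl_linear₁ _ _).map_smul, Finset.smul_sum]

theorem IsTorsionFreeSmooth.weylCon_linear₂ (hD : IsTorsionFreeSmooth D) (u : Tan n x) :
    IsLinearMap ℝ fun τ ↦ weylCon D u τ := by
  constructor
  · intro u v
    simp only [weylCon, add_apply, (hD.weyl_linear₃ _ _).map_add, Finset.sum_add_distrib]
  · intro c u
    simp only [weylCon, smul_apply, (hD.weyl_linear₃ _ _).map_smul, Finset.smul_sum]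

theorem IsTorsionFreeSmooth.cottonCon_linear₁ (hD : IsTorsionFreeSmooth D) (τ : Con2 n x) :
    IsLinearMap ℝ fun u ↦ cottonCon D u τ := by
  constructor
  · intro u v
    simp only [cottonCon, (hD.cotton_linear₁ _ _).map_add, Finset.sum_add_distrib]
  · intro c u
    simp only [cottonCon, (hD.cotton_linear₁ _ _).map_smul, Finset.smul_sum]

theorem IsTorsionFreeSmooth.cottonCon_linear₂ (hD : IsTorsionFreeSmooth D) (u : Tan n x) :
    IsLinearMap ℝ fun τ ↦ cottonCon D u τ := by
  constructor
  · intro u v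
    simp only [cottonCon, add_apply, (hD.cotton_linear₃ _ _).map_add, Finset.sum_add_distrib]
  · intro c u
    simp only [cottonCon, smul_apply, (hD.cotton_linear₃ _ _).map_smul, Finset.smul_sum]

variable {Y : Π x : M, Tan n x} {τ : Π x : M, Con2 n x}

theorem IsTorsionFreeSmooth.schoutenCon_eventually (hD : IsTorsionFreeSmooth D) :
    ∀ᶠ y in 𝓝 x, schoutenCon D (Y y) (τ y)
      = ∑ i, schouten D (Y y) (frame x i y) • τ y (coframe x i y) := by
  filter_upwards [coframe_frame (n := n) x] with y hy
  refine contract_eq (cotBasis_tanBasis y) hy (fun v α ↦ schouten D (Y y) v • τ y α)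
    (fun α ↦ ⟨fun v v' ↦ ?_, fun c v ↦ ?_⟩) fun v ↦ ⟨fun α β ↦ ?_, fun c α ↦ ?_⟩
  · rw [(hD.schouten_linear₂ _).map_add, add_smul]
  · rw [(hD.schouten_linear₂ _).map_smul, smul_assoc]
  · rw [map_add, smul_add]
  · rw [map_smul, smul_comm]

theorem IsTorsionFreeSmooth.weylCon_eventually (hD : IsTorsionFreeSmooth D) :
    ∀ᶠ y in 𝓝 x, weylCon D (Y y) (τ y)
      = ∑ i, weyl D (Y y) (frame x i y) (τ y (coframe x i y)) := by
  filter_upwards [coframe_frame (n := n) x] with y hy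
  refine contract_eq (cotBasis_tanBasis y) hy (fun v α ↦ weyl D (Y y) v (τ y α))
    (fun α ↦ hD.weyl_linear₂ _ _) fun v ↦ ⟨fun α β ↦ ?_, fun c α ↦ ?_⟩
  · rw [map_add, (hD.weyl_linear₃ _ _).map_add]
  · rw [map_smul, (hD.weyl_linear₃ _ _).map_smul]

theorem IsTorsionFreeSmooth.cottonCon_eventually (hD : IsTorsionFreeSmooth D) :
    ∀ᶠ y in 𝓝 x, cottonCon D (Y y) (τ y)
      = ∑ i, cotton D (Y y) (frame x i y) (τ y (coframe x i y)) := by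
  filter_upwards [coframe_frame (n := n) x] with y hy
  refine contract_eq (cotBasis_tanBasis y) hy (fun v α ↦ cotton D (Y y) v (τ y α))
    (fun α ↦ hD.cotton_linear₂ _ _) fun v ↦ ⟨fun α β ↦ ?_, fun c α ↦ ?_⟩
  · rw [map_add, (hD.cotton_linear₃ _ _).map_add]
  · rw [map_smul, (hD.cotton_linear₃ _ _).map_smul]

theorem IsTorsionFreeSmooth.schoutenCon_smooth (hD : IsTorsionFreeSmooth D)
    (hY : SmoothTanNear Y x) (hτ : SmoothCon2Near τ x) :
    SmoothTanNear (fun y ↦ schoutenCon D (Y y) (τ y)) x :=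
  (SmoothTanNear.sum fun i ↦ .smul (hD.schouten_smooth hY (smoothTanNear_frame x i))
    (hτ.apply (smoothCotNear_coframe x i))).congr hD.schoutenCon_eventually

theorem IsTorsionFreeSmooth.weylCon_smooth (hD : IsTorsionFreeSmooth D)
    (hY : SmoothTanNear Y x) (hτ : SmoothCon2Near τ x) :
    SmoothTanNear (fun y ↦ weylCon D (Y y) (τ y)) x :=
  (SmoothTanNear.sum fun i ↦ hD.weyl_smooth hY (smoothTanNear_frame x i)
    (hτ.apply (smoothCotNear_coframe x i))).congr hD.weylCon_eventually

theorem IsTorsionFreeSmooth.cottonCon_smooth (hD : IsTorsionFreeSmooth D)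
    (hY : SmoothTanNear Y x) (hτ : SmoothCon2Near τ x) :
    SmoothFunNear n (fun y ↦ cottonCon D (Y y) (τ y)) x :=
  (SmoothFunNear.sum fun i ↦ hD.cotton_smooth hY (smoothTanNear_frame x i)
    (hτ.apply (smoothCotNear_coframe x i))).congr hD.cottonCon_eventually

/-- Covariant differentiation commutes with contraction; the proof differentiates the contraction
written in the local frame. -/
theorem IsTorsionFreeSmooth.nabla_schoutenCon (hD : IsTorsionFreeSmooth D) (u : Tan n x)
    (hY : SmoothTanNear Y x) (hτ : SmoothCon2Near τ x) :
    D (fun y ↦ schoutenCon D (Y y) (τ y)) x u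
      = ∑ i, covSchouten D u (Y x) (tanBasis x i) • τ x (cotBasis x i)
        + schoutenCon D (D Y x u) (τ x)
        + schoutenCon D (Y x) (ProjProlong.covCon2 D τ x u) := by
  have s1 := fun i ↦ hD.schouten_smooth hY (smoothTanNear_frame x i)
  have s2 := fun i ↦ hτ.apply (smoothCotNear_coframe x i)
  rw [nabla_congr D u (SmoothTanNear.sum fun i ↦ .smul (s1 i) (s2 i)) hD.schoutenCon_eventually,
    nabla_sum D u fun i ↦ .smul (s1 i) (s2 i)]
  have h1 : ∀ i, D (fun y ↦ schouten D (Y y) (frame x i y) • τ y (coframe x i y)) x u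
      = covSchouten D u (Y x) (tanBasis x i) • τ x (cotBasis x i)
        + schouten D (D Y x u) (tanBasis x i) • τ x (cotBasis x i)
        + schouten D (Y x) (tanBasis x i) • ProjProlong.covCon2 D τ x u (cotBasis x i)
        + (schouten D (Y x) (D (frame x i) x u) • τ x (cotBasis x i)
          + schouten D (Y x) (tanBasis x i)
            • τ x (ProjProlong.covCot D (coframe x i) x u)) := fun i ↦ by
    have h2 := hD.covSchouten_apply u hY (smoothTanNear_frame x i)
    have h3 := covCon2_apply D u hτ (smoothCotNear_coframe x i)
    rw [frame_self] at h2
    rw [coframe_self] at h3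
    rw [nabla_smul D u (s1 i) (s2 i), h2, h3, frame_self, coframe_self]
    module
  -- The derivatives of the frame and of the coframe cancel, by `covCot_coframe`.
  have h4 : ∑ i, (schouten D (Y x) (D (frame x i) x u) • τ x (cotBasis x i)
      + schouten D (Y x) (tanBasis x i) • τ x (ProjProlong.covCot D (coframe x i) x u)) = 0 := by
    have h5 : ∀ i, schouten D (Y x) (D (frame x i) x u) • τ x (cotBasis x i)
        = ∑ j, ((cotBasis x j (D (frame x i) x u) : ℝ) * schouten D (Y x) (tanBasis x j))
          • τ x (cotBasis x i) := fun i ↦ by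
      conv_lhs => rw [dual_expand (cotBasis_tanBasis x) (D (frame x i) x u)]
      rw [← (hD.schouten_linear₂ _).mk'_apply, map_sum, Finset.sum_smul]
      simp only [map_smul, IsLinearMap.mk'_apply, smul_eq_mul]
    have h6 : ∀ i, schouten D (Y x) (tanBasis x i) • τ x (ProjProlong.covCot D (coframe x i) x u)
        = -∑ j, ((cotBasis x i (D (frame x j) x u) : ℝ) * schouten D (Y x) (tanBasis x i))
          • τ x (cotBasis x j) := fun i ↦ by
      rw [covCot_coframe, map_neg, map_sum, smul_neg, Finset.smul_sum]
      simp only [map_smul, smul_smul, mul_comm]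
    rw [Finset.sum_add_distrib, Finset.sum_congr rfl fun i _ ↦ h5 i,
      Finset.sum_congr rfl fun i _ ↦ h6 i, Finset.sum_neg_distrib, Finset.sum_comm, add_neg_cancel]
  rw [Finset.sum_congr rfl fun i _ ↦ h1 i, Finset.sum_add_distrib, h4, add_zero,
    Finset.sum_add_distrib, Finset.sum_add_distrib]
  rfl

theorem schoutenCon_symProd (hD : IsTorsionFreeSmooth D) (u v w : Tan n x) :
    schoutenCon D u (symProd v w) = schouten D u v • w + schouten D u w • v := by
  have h : ∀ v, ∑ i, schouten D u (tanBasis x i) * (cotBasis x i v : ℝ) = schouten D u v :=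
    fun v ↦ by
    conv_rhs => rw [dual_expand (cotBasis_tanBasis x) v]
    rw [← (hD.schouten_linear₂ _).mk'_apply, map_sum]
    simp only [map_smul, IsLinearMap.mk'_apply, smul_eq_mul, mul_comm]
  simp only [schoutenCon, symProd_apply, smul_add, smul_smul, Finset.sum_add_distrib,
    ← Finset.sum_smul, h]

theorem apply_schoutenCon (hD : IsTorsionFreeSmooth D) (u : Tan n x) {σ : Con2 n x}
    (hσ : IsSymm2 σ) (α : Cot n x) : (α (schoutenCon D u σ) : ℝ) = schouten D u (σ α) := by
  conv_rhs => rw [dual_expand (cotBasis_tanBasis x) (σ α)]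
  rw [← (hD.schouten_linear₂ _).mk'_apply, map_sum, schoutenCon, map_sum]
  refine Finset.sum_congr rfl fun i _ ↦ ?_
  rw [map_smul, map_smul, IsLinearMap.mk'_apply, smul_eq_mul, smul_eq_mul, hσ α, mul_comm]

/-- Both sides are P_{ac} P_{bd} σ^{cd} u^a v^b once σ is symmetric. This removes the term quadratic
in P from the bottom slot. -/
theorem schouten_schoutenCon (hD : IsTorsionFreeSmooth D)
    (u v : Tan n x) {σ : Con2 n x}
    (hσ : IsSymm2 σ) :
    schouten D u (schoutenCon D v σ) = schouten D v (schoutenCon D u σ) := by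
  have e : ∀ u v : Tan n x, schouten D u (schoutenCon D v σ)
      = ∑ i, schouten D v (tanBasis x i) * schouten D u (σ (cotBasis x i)) := fun u v ↦ by
    rw [schoutenCon, ← (hD.schouten_linear₂ _).mk'_apply, map_sum]
    simp only [map_smul, IsLinearMap.mk'_apply, smul_eq_mul]
  have e' : ∀ u v : Tan n x, schouten D u (schoutenCon D v σ)
      = ∑ i, ∑ j, (cotBasis x j (σ (cotBasis x i)) : ℝ)
          * (schouten D v (tanBasis x i) * schouten D u (tanBasis x j)) := fun u v ↦ by
    rw [e]
    refine Finset.sum_congr rfl fun i _ ↦ ?_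
    conv_lhs => rw [dual_expand (cotBasis_tanBasis x) (σ (cotBasis x i))]
    rw [← (hD.schouten_linear₂ u).mk'_apply, map_sum, Finset.mul_sum]
    simp only [map_smul, IsLinearMap.mk'_apply, smul_eq_mul]
    exact Finset.sum_congr rfl fun j _ ↦ by ring
  rw [e', e', Finset.sum_comm]
  refine Finset.sum_congr rfl fun i _ ↦ Finset.sum_congr rfl fun j _ ↦ ?_
  rw [hσ]
  ring

/-- `(∇_u U)(Y, τ)` for the contraction `U(v, τ)` of the Weyl curvature with `τ`. -/
def covWeylConField (D : Conn n M) (u : Tan n x) (Y : Π x : M, Tan n x)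
    (τ : Π x : M, Con2 n x) : Tan n x :=
  D (fun y ↦ weylCon D (Y y) (τ y)) x u - weylCon D (D Y x u) (τ x)
    - weylCon D (Y x) (covCon2 D τ x u)

/-- `(∇_u C)(Y, τ)` for the contraction `C(v, τ)` of the Cotton-York tensor with `τ`. -/
def covCottonConField (D : Conn n M) (u : Tan n x) (Y : Π x : M, Tan n x)
    (τ : Π x : M, Con2 n x) : ℝ :=
  dFun (fun y ↦ cottonCon D (Y y) (τ y)) x u - cottonCon D (D Y x u) (τ x)
    - cottonCon D (Y x) (covCon2 D τ x u)

/-- Treating U as a bilinear map of (v, τ) gives ∇W contracted with σ directly, without ∇W as a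
separate tensor. Tensoriality in both arguments makes it a pointwise expression. -/
theorem IsTorsionFreeSmooth.covWeylConField_tensorial₁ (hD : IsTorsionFreeSmooth D) (u : Tan n x)
    (hτ : SmoothCon2Near τ x) :
    TensorialNear n (SmoothTanNear · x) (fun Y ↦ covWeylConField D u Y τ) x where
  add {V V'} hV hV' := by
    simp only [covWeylConField]
    rw [nabla_add D _ hV hV', (hD.weylCon_linear₁ _).map_add, (hD.weylCon_linear₁ _).map_add]
    simp only [(hD.weylCon_linear₁ _).map_add]
    rw [nabla_add D _ (hD.weylCon_smooth hV hτ) (hD.weylCon_smooth hV' hτ)]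
    abel
  smul {f V} hf hV := by
    simp only [covWeylConField]
    rw [nabla_smul D _ hf hV, (hD.weylCon_linear₁ _).map_add, (hD.weylCon_linear₁ _).map_smul,
      (hD.weylCon_linear₁ _).map_smul]
    simp only [(hD.weylCon_linear₁ _).map_smul]
    rw [nabla_smul D _ hf (hD.weylCon_smooth hV hτ)]
    module
  congr {V V'} hV hV' h := by
    simp only [covWeylConField]
    rw [nabla_congr D _ hV' h, h.self_of_nhds,
      nabla_congr D (X := fun y ↦ weylCon D (V' y) (τ y)) _ (hD.weylCon_smooth hV' hτ)]
    filter_upwards [h] with y hy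
    rw [hy]

theorem IsTorsionFreeSmooth.covWeylConField_tensorial₂ (hD : IsTorsionFreeSmooth D) (u : Tan n x)
    (hY : SmoothTanNear Y x) :
    TensorialNear n (SmoothCon2Near · x) (fun τ ↦ covWeylConField D u Y τ) x where
  add {V V'} hV hV' := by
    simp only [covWeylConField]
    rw [covCon2_add D _ hV hV', (hD.weylCon_linear₂ _).map_add, (hD.weylCon_linear₂ _).map_add]
    simp only [(hD.weylCon_linear₂ _).map_add]
    rw [nabla_add D _ (hD.weylCon_smooth hY hV) (hD.weylCon_smooth hY hV')]
    abel
  smul {f V} hf hV := by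
    simp only [covWeylConField]
    rw [covCon2_smul D _ hf hV, (hD.weylCon_linear₂ _).map_add, (hD.weylCon_linear₂ _).map_smul,
      (hD.weylCon_linear₂ _).map_smul]
    simp only [(hD.weylCon_linear₂ _).map_smul]
    rw [nabla_smul D _ hf (hD.weylCon_smooth hY hV)]
    module
  congr {V V'} hV hV' h := by
    simp only [covWeylConField]
    rw [covCon2_congr D _ hV' h, h.self_of_nhds,
      nabla_congr D (X := fun y ↦ weylCon D (Y y) (V' y)) _ (hD.weylCon_smooth hY hV')]
    filter_upwards [h] with y hy
    rw [hy]

theorem IsTorsionFreeSmooth.covCottonConField_tensorial₁ (hD : IsTorsionFreeSmooth D)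
    (u : Tan n x) (hτ : SmoothCon2Near τ x) :
    TensorialNear n (SmoothTanNear · x) (fun Y ↦ covCottonConField D u Y τ) x where
  add {V V'} hV hV' := by
    simp only [covCottonConField]
    rw [nabla_add D _ hV hV', (hD.cottonCon_linear₁ _).map_add, (hD.cottonCon_linear₁ _).map_add]
    simp only [(hD.cottonCon_linear₁ _).map_add]
    rw [dFun_add _ (hD.cottonCon_smooth hV hτ) (hD.cottonCon_smooth hV' hτ)]
    ring
  smul {f V} hf hV := by
    simp only [covCottonConField]
    rw [nabla_smul D _ hf hV, (hD.cottonCon_linear₁ _).map_add, (hD.cottonCon_linear₁ _).map_smul,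
      (hD.cottonCon_linear₁ _).map_smul]
    simp only [(hD.cottonCon_linear₁ _).map_smul, smul_eq_mul]
    rw [dFun_mul _ hf (hD.cottonCon_smooth hV hτ)]
    ring
  congr {V V'} hV hV' h := by
    simp only [covCottonConField]
    rw [nabla_congr D _ hV' h, h.self_of_nhds,
      dFun_congr (g := fun y ↦ cottonCon D (V' y) (τ y))]
    filter_upwards [h] with y hy
    rw [hy]

theorem IsTorsionFreeSmooth.covCottonConField_tensorial₂ (hD : IsTorsionFreeSmooth D)
    (u : Tan n x) (hY : SmoothTanNear Y x) :
    TensorialNear n (SmoothCon2Near · x) (fun τ ↦ covCottonConField D u Y τ) x where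
  add {V V'} hV hV' := by
    simp only [covCottonConField]
    rw [covCon2_add D _ hV hV', (hD.cottonCon_linear₂ _).map_add,
      (hD.cottonCon_linear₂ _).map_add]
    simp only [(hD.cottonCon_linear₂ _).map_add]
    rw [dFun_add _ (hD.cottonCon_smooth hY hV) (hD.cottonCon_smooth hY hV')]
    ring
  smul {f V} hf hV := by
    simp only [covCottonConField]
    rw [covCon2_smul D _ hf hV, (hD.cottonCon_linear₂ _).map_add,
      (hD.cottonCon_linear₂ _).map_smul, (hD.cottonCon_linear₂ _).map_smul]
    simp only [(hD.cottonCon_linear₂ _).map_smul, smul_eq_mul]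
    rw [dFun_mul _ hf (hD.cottonCon_smooth hY hV)]
    ring
  congr {V V'} hV hV' h := by
    simp only [covCottonConField]
    rw [covCon2_congr D _ hV' h, h.self_of_nhds,
      dFun_congr (g := fun y ↦ cottonCon D (Y y) (V' y))]
    filter_upwards [h] with y hy
    rw [hy]

/-- `(∇_u U)(v, τ)` for the contraction `U(v, τ)` of the Weyl curvature with `τ`. -/
def covWeylCon (D : Conn n M) (u v : Tan n x) (τ : Con2 n x) : Tan n x :=
  ∑ i, ∑ p : Fin n × Fin n, ((cotBasis x i v : ℝ) * (cotBasis x p.1 (τ (cotBasis x p.2)) : ℝ))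
    • covWeylConField D u (frame x i) (frame2 x p)

/-- `(∇_u C)(v, τ)` for the contraction `C(v, τ)` of the Cotton-York tensor with `τ`. -/
def covCottonCon (D : Conn n M) (u v : Tan n x) (τ : Con2 n x) : ℝ :=
  ∑ i, ∑ p : Fin n × Fin n, ((cotBasis x i v : ℝ) * (cotBasis x p.1 (τ (cotBasis x p.2)) : ℝ))
    • covCottonConField D u (frame x i) (frame2 x p)

/-- `covWeylCon` is a frame expansion, manifestly linear in v and τ; this identifies it with the
derivative along actual fields. -/
theorem IsTorsionFreeSmooth.covWeylCon_apply (hD : IsTorsionFreeSmooth D) (u : Tan n x)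
    (hY : SmoothTanNear Y x) (hτ : SmoothCon2Near τ x) :
    covWeylCon D u (Y x) (τ x) = covWeylConField D u Y τ := by
  rw [(hD.covWeylConField_tensorial₁ u hτ).tan_eq_sum hY, covWeylCon]
  refine Finset.sum_congr rfl fun i _ ↦ ?_
  rw [(hD.covWeylConField_tensorial₂ u (smoothTanNear_frame x i)).con2_eq_sum hτ,
    Finset.smul_sum]
  exact Finset.sum_congr rfl fun p _ ↦ mul_smul _ _ _

theorem IsTorsionFreeSmooth.covCottonCon_apply (hD : IsTorsionFreeSmooth D) (u : Tan n x)
    (hY : SmoothTanNear Y x) (hτ : SmoothCon2Near τ x) :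
    covCottonCon D u (Y x) (τ x) = covCottonConField D u Y τ := by
  rw [(hD.covCottonConField_tensorial₁ u hτ).tan_eq_sum hY, covCottonCon]
  refine Finset.sum_congr rfl fun i _ ↦ ?_
  rw [(hD.covCottonConField_tensorial₂ u (smoothTanNear_frame x i)).con2_eq_sum hτ,
    Finset.smul_sum]
  exact Finset.sum_congr rfl fun p _ ↦ mul_smul _ _ _

end contractions

end

/-! ### The family ∇ + cΦ and its curvature, slot by slot. -/

section

/-- A map that is linear in each of three arguments, antisymmetrized in the first two. -/
def antisymmTrilinear {U T W : Type*} [AddCommMonoid U] [Module ℝ U] [AddCommMonoid T] [Module ℝ T]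
    [AddCommGroup W] [Module ℝ W] (f : U → U → T → W) (h₁ : ∀ v t, IsLinearMap ℝ fun u ↦ f u v t)
    (h₂ : ∀ u t, IsLinearMap ℝ fun v ↦ f u v t) (h₃ : ∀ u v, IsLinearMap ℝ fun t ↦ f u v t) :
    U →ₗ[ℝ] U →ₗ[ℝ] T →ₗ[ℝ] W :=
  LinearMap.mk₂ ℝ (fun u v ↦ (h₃ u v).mk' _ - (h₃ v u).mk' _)
    (fun u u' v ↦ LinearMap.ext fun t ↦ by
      simp only [LinearMap.sub_apply, LinearMap.add_apply, IsLinearMap.mk'_apply,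
        (h₁ v t).map_add, (h₂ v t).map_add]
      abel)
    (fun c u v ↦ LinearMap.ext fun t ↦ by
      simp only [LinearMap.sub_apply, LinearMap.smul_apply, IsLinearMap.mk'_apply,
        (h₁ v t).map_smul, (h₂ v t).map_smul, smul_sub])
    (fun u v v' ↦ LinearMap.ext fun t ↦ by
      simp only [LinearMap.sub_apply, LinearMap.add_apply, IsLinearMap.mk'_apply,
        (h₁ u t).map_add, (h₂ u t).map_add]
      abel)
    (fun c u v ↦ LinearMap.ext fun t ↦ by
      simp only [LinearMap.sub_apply, LinearMap.smul_apply, IsLinearMap.mk'_apply,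
        (h₁ u t).map_smul, (h₂ u t).map_smul, smul_sub])

theorem antisymmTrilinear_self {U T W : Type*} [AddCommMonoid U] [Module ℝ U] [AddCommMonoid T]
    [Module ℝ T] [AddCommGroup W] [Module ℝ W] {f : U → U → T → W}
    (h₁ : ∀ v t, IsLinearMap ℝ fun u ↦ f u v t) (h₂ : ∀ u t, IsLinearMap ℝ fun v ↦ f u v t)
    (h₃ : ∀ u v, IsLinearMap ℝ fun t ↦ f u v t) (u : U) :
    antisymmTrilinear f h₁ h₂ h₃ u u = 0 :=
  LinearMap.ext fun _ ↦ sub_self _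

variable {n : ℕ} {M : Type*} [TopologicalSpace M] [ChartedSpace (EuclideanSpace ℝ (Fin n)) M]

variable [IsManifold (𝓡 n) ∞ M] {D : Conn n M}

/-- The tractor connection minus `c (0, W_{ac}{}^b{}_d σ^{cd}, 4 Y_{abc} σ^{bc})`. -/
def modConn (D : Conn n M) (c : ℝ) (s : Π x : M, Fib n x) (x : M) (u : Tan n x) : Fib n x :=
  (covCon2 D (fun y ↦ (s y).1) x u - symProd u (s x).2.1,
    D (fun y ↦ (s y).2.1) x u - (s x).2.2 • u + schoutenCon D u (s x).1
      - c • weylCon D u (s x).1,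
    dFun (fun y ↦ (s y).2.2) x u + 2 * schouten D u (s x).2.1
      - (4 * c) * cottonCon D u (s x).1)

theorem tractorConn_eq (D : Conn n M) : tractorConn D = modConn D 0 := by
  funext s x u
  simp only [tractorConn, modConn, zero_smul, mul_zero, zero_mul, sub_zero]

theorem prolongedConn_eq (D : Conn n M) : prolongedConn D = modConn D (1 / n) := by
  funext s x u
  simp only [prolongedConn, modConn, mul_one_div]

/-- The part of the middle slot of the curvature of `modConn` that is linear in `c`, before
antisymmetrization. -/
def midCorrection (D : Conn n M) {x : M} (u v : Tan n x) (t : Fib n x) : Tan n x :=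
  (4 * cottonCon D v t.1) • u + weylCon D u (symProd v t.2.1) - covWeylCon D u v t.1

/-- The part of the bottom slot of the curvature of `modConn` that is linear in `c`, before
antisymmetrization. -/
def botCorrection (D : Conn n M) {x : M} (u v : Tan n x) (t : Fib n x) : ℝ :=
  4 * cottonCon D u (symProd v t.2.1) - 2 * schouten D u (weylCon D v t.1)
    - 4 * covCottonCon D u v t.1

theorem covWeylCon_linear₂ (D : Conn n M) {x : M} (u : Tan n x) (τ : Con2 n x) :
    IsLinearMap ℝ fun v ↦ covWeylCon D u v τ := by
  constructor
  · intro v v'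
    simp only [covWeylCon, map_add, add_mul, add_smul, Finset.sum_add_distrib]
  · intro c v
    simp only [covWeylCon, map_smul, smul_eq_mul, mul_assoc, Finset.smul_sum, mul_smul]

theorem covWeylCon_linear₃ (D : Conn n M) {x : M} (u v : Tan n x) :
    IsLinearMap ℝ fun τ ↦ covWeylCon D u v τ := by
  constructor
  · intro τ τ'
    simp only [covWeylCon, add_apply, map_add, mul_add, add_smul, Finset.sum_add_distrib]
  · intro c τ
    simp only [covWeylCon, smul_apply, map_smul, smul_eq_mul, mul_left_comm _ c,
      Finset.smul_sum, mul_smul c]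

theorem covCottonCon_linear₂ (D : Conn n M) {x : M} (u : Tan n x) (τ : Con2 n x) :
    IsLinearMap ℝ fun v ↦ covCottonCon D u v τ := by
  constructor
  · intro v v'
    simp only [covCottonCon, map_add, add_mul, add_smul, Finset.sum_add_distrib]
  · intro c v
    simp only [covCottonCon, map_smul, smul_eq_mul, mul_assoc, Finset.mul_sum]

theorem covCottonCon_linear₃ (D : Conn n M) {x : M} (u v : Tan n x) :
    IsLinearMap ℝ fun τ ↦ covCottonCon D u v τ := by
  constructor
  · intro τ τ'
    simp only [covCottonCon, add_apply, map_add, mul_add, add_smul, Finset.sum_add_distrib]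
  · intro c τ
    simp only [covCottonCon, smul_apply, map_smul, smul_eq_mul, mul_left_comm _ c,
      Finset.mul_sum, mul_assoc]

variable [T2Space M]

section linear

variable {x : M}

theorem IsTorsionFreeSmooth.covWeylCon_linear₁ (hD : IsTorsionFreeSmooth D) (v : Tan n x)
    (τ : Con2 n x) : IsLinearMap ℝ fun u ↦ covWeylCon D u v τ := by
  constructor
  · intro u u'
    simp only [covWeylCon, ← Finset.sum_add_distrib, ← smul_add]
    refine Finset.sum_congr rfl fun i _ ↦ Finset.sum_congr rfl fun p _ ↦ ?_
    simp only [covWeylConField, map_add, covCon2_add_right, (hD.weylCon_linear₁ _).map_add,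
      (hD.weylCon_linear₂ _).map_add]
    module
  · intro c u
    simp only [covWeylCon, Finset.smul_sum]
    refine Finset.sum_congr rfl fun i _ ↦ Finset.sum_congr rfl fun p _ ↦ ?_
    simp only [covWeylConField, map_smul, covCon2_smul_right, (hD.weylCon_linear₁ _).map_smul,
      (hD.weylCon_linear₂ _).map_smul]
    module

theorem IsTorsionFreeSmooth.covCottonCon_linear₁ (hD : IsTorsionFreeSmooth D) (v : Tan n x)
    (τ : Con2 n x) : IsLinearMap ℝ fun u ↦ covCottonCon D u v τ := by
  constructor
  · intro u u'
    simp only [covCottonCon, ← Finset.sum_add_distrib, ← smul_add]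
    refine Finset.sum_congr rfl fun i _ ↦ Finset.sum_congr rfl fun p _ ↦ ?_
    simp only [covCottonConField, map_add, covCon2_add_right, (hD.cottonCon_linear₁ _).map_add,
      (hD.cottonCon_linear₂ _).map_add, dFun_add_right, smul_eq_mul]
    ring
  · intro c u
    simp only [covCottonCon, Finset.smul_sum]
    refine Finset.sum_congr rfl fun i _ ↦ Finset.sum_congr rfl fun p _ ↦ ?_
    simp only [covCottonConField, map_smul, covCon2_smul_right, (hD.cottonCon_linear₁ _).map_smul,
      (hD.cottonCon_linear₂ _).map_smul, dFun_smul_right, smul_eq_mul]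
    ring

theorem IsTorsionFreeSmooth.midCorrection_linear₁ (hD : IsTorsionFreeSmooth D) (v : Tan n x)
    (t : Fib n x) : IsLinearMap ℝ fun u ↦ midCorrection D u v t := by
  constructor
  · intro u u'
    simp only [midCorrection, (hD.weylCon_linear₁ _).map_add, (hD.covWeylCon_linear₁ _ _).map_add]
    module
  · intro c u
    simp only [midCorrection, (hD.weylCon_linear₁ _).map_smul,
      (hD.covWeylCon_linear₁ _ _).map_smul]
    module

theorem IsTorsionFreeSmooth.midCorrection_linear₂ (hD : IsTorsionFreeSmooth D) (u : Tan n x)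
    (t : Fib n x) : IsLinearMap ℝ fun v ↦ midCorrection D u v t := by
  constructor
  · intro v v'
    simp only [midCorrection, (hD.weylCon_linear₂ _).map_add, (hD.cottonCon_linear₁ _).map_add,
      (covWeylCon_linear₂ _ _ _).map_add, (symProd_linear₁ _).map_add]
    module
  · intro c v
    simp only [midCorrection, (hD.weylCon_linear₂ _).map_smul, (hD.cottonCon_linear₁ _).map_smul,
      (covWeylCon_linear₂ _ _ _).map_smul, (symProd_linear₁ _).map_smul, smul_eq_mul]
    module

theorem IsTorsionFreeSmooth.midCorrection_linear₃ (hD : IsTorsionFreeSmooth D) (u v : Tan n x) :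
    IsLinearMap ℝ fun t : Fib n x ↦ midCorrection D u v t := by
  constructor
  · intro v v'
    simp only [midCorrection, Prod.fst_add, Prod.snd_add, (hD.weylCon_linear₂ _).map_add,
      (hD.cottonCon_linear₂ _).map_add, (covWeylCon_linear₃ _ _ _).map_add,
      (symProd_linear₂ _).map_add]
    module
  · intro c v
    simp only [midCorrection, Prod.smul_fst, Prod.smul_snd, (hD.weylCon_linear₂ _).map_smul,
      (hD.cottonCon_linear₂ _).map_smul, (covWeylCon_linear₃ _ _ _).map_smul,
      (symProd_linear₂ _).map_smul, smul_eq_mul]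
    module

theorem IsTorsionFreeSmooth.botCorrection_linear₁ (hD : IsTorsionFreeSmooth D) (v : Tan n x)
    (t : Fib n x) : IsLinearMap ℝ fun u ↦ botCorrection D u v t := by
  constructor
  · intro u u'
    simp only [botCorrection, (hD.cottonCon_linear₁ _).map_add, (hD.schouten_linear₁ _).map_add,
      (hD.covCottonCon_linear₁ _ _).map_add]
    ring
  · intro c u
    simp only [botCorrection, (hD.cottonCon_linear₁ _).map_smul, (hD.schouten_linear₁ _).map_smul,
      (hD.covCottonCon_linear₁ _ _).map_smul, smul_eq_mul]
    ring

theorem IsTorsionFreeSmooth.botCorrection_linear₂ (hD : IsTorsionFreeSmooth D) (u : Tan n x)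
    (t : Fib n x) : IsLinearMap ℝ fun v ↦ botCorrection D u v t := by
  constructor
  · intro v v'
    simp only [botCorrection, (hD.cottonCon_linear₂ _).map_add, (hD.schouten_linear₂ _).map_add,
      (hD.weylCon_linear₁ _).map_add, (covCottonCon_linear₂ _ _ _).map_add,
      (symProd_linear₁ _).map_add]
    ring
  · intro c v
    simp only [botCorrection, (hD.cottonCon_linear₂ _).map_smul, (hD.schouten_linear₂ _).map_smul,
      (hD.weylCon_linear₁ _).map_smul, (covCottonCon_linear₂ _ _ _).map_smul,
      (symProd_linear₁ _).map_smul, smul_eq_mul]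
    ring

theorem IsTorsionFreeSmooth.botCorrection_linear₃ (hD : IsTorsionFreeSmooth D) (u v : Tan n x) :
    IsLinearMap ℝ fun t : Fib n x ↦ botCorrection D u v t := by
  constructor
  · intro t t'
    simp only [botCorrection, Prod.fst_add, Prod.snd_add, (hD.cottonCon_linear₂ _).map_add,
      (hD.schouten_linear₂ _).map_add, (hD.weylCon_linear₂ _).map_add,
      (covCottonCon_linear₃ _ _ _).map_add, (symProd_linear₂ _).map_add]
    ring
  · intro c t
    simp only [botCorrection, Prod.smul_fst, Prod.smul_snd, (hD.cottonCon_linear₂ _).map_smul,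
      (hD.schouten_linear₂ _).map_smul, (hD.weylCon_linear₂ _).map_smul,
      (covCottonCon_linear₃ _ _ _).map_smul, (symProd_linear₂ _).map_smul, smul_eq_mul]
    ring

end linear

/-! ### The curvature of the connections -/

section curvature

variable {X Y : Π x : M, Tan n x} {σ : Π x : M, Con2 n x} {μ : Π x : M, Tan n x} {ρ : M → ℝ}
  {x : M}

/-- The action of the curvature on `σ^{bc}` in terms of the Weyl curvature. -/
theorem IsTorsionFreeSmooth.ricci_con2_weyl (hD : IsTorsionFreeSmooth D)
    (hσ : SmoothCon2Near σ x) (hσs : IsSymm2 (σ x)) (hX : SmoothTanNear X x)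
    (hY : SmoothTanNear Y x) :
    ProjProlong.covCon2 D (fun y ↦ ProjProlong.covCon2 D σ y (Y y)) x (X x)
      - ProjProlong.covCon2 D (fun y ↦ ProjProlong.covCon2 D σ y (X y)) x (Y x)
      - ProjProlong.covCon2 D σ x (VectorField.mlieBracket (𝓡 n) X Y x)
      - symProd (X x) (schoutenCon D (Y x) (σ x)) + symProd (Y x) (schoutenCon D (X x) (σ x))
      = ∑ i, symProd (weyl D (X x) (Y x) (tanBasis x i)) (σ x (cotBasis x i)) := by
  refine ContinuousLinearMap.ext fun α ↦ ?_
  rw [add_apply, sub_apply, hD.ricci_con2 hσ hX hY, symProd_apply, symProd_apply, sum_apply,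
    apply_schoutenCon hD _ hσs, apply_schoutenCon hD _ hσs]
  simp only [symProd_apply, Finset.sum_add_distrib]
  have h1 : ∑ i, (α (σ x (cotBasis x i)) : ℝ) • weyl D (X x) (Y x) (tanBasis x i)
      = weyl D (X x) (Y x) (σ x α) := by
    conv_rhs => rw [dual_expand (cotBasis_tanBasis x) (σ x α)]
    rw [← (hD.weyl_linear₃ _ _).mk'_apply, map_sum]
    refine Finset.sum_congr rfl fun i _ ↦ ?_
    rw [map_smul, IsLinearMap.mk'_apply, hσs]
  have h2 : ∑ i, (α (weyl D (X x) (Y x) (tanBasis x i)) : ℝ) • σ x (cotBasis x i)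
      = ∑ i, (α (riem D (X x) (Y x) (tanBasis x i)) : ℝ) • σ x (cotBasis x i)
        - (α (X x) : ℝ) • schoutenCon D (Y x) (σ x)
        + (α (Y x) : ℝ) • schoutenCon D (X x) (σ x) := by
    simp only [schoutenCon, Finset.smul_sum]
    rw [← Finset.sum_sub_distrib, ← Finset.sum_add_distrib]
    refine Finset.sum_congr rfl fun i _ ↦ ?_
    simp only [weyl, map_add, map_sub, map_smul, smul_eq_mul]
    module
  rw [h1, h2, weyl]
  module

-- The only c-term arises when the -cU of the middle slot is fed into the μ-terms of the outer
-- connection. Derivatives of μ and the ρ-term are symmetric in X and Y, the terms in ∇_X Y cancel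
-- against the bracket, and `ricci_con2_weyl` handles the rest.
set_option synthInstance.maxHeartbeats 400000 in
theorem IsTorsionFreeSmooth.modConn_top (hD : IsTorsionFreeSmooth D) (c : ℝ)
    {s : Π x : M, Fib n x} (hσ : SmoothCon2Near (fun y ↦ (s y).1) x) (hσs : IsSymm2 (s x).1)
    (hμ : SmoothTanNear (fun y ↦ (s y).2.1) x) (hX : SmoothTanNear X x)
    (hY : SmoothTanNear Y x) :
    (fibCurv (modConn D c) X Y s x).1 = (tractorCurv D (X x) (Y x) (s x)).1
      + c • correctionTop D (X x) (Y x) (s x).1 := by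
  -- The bracketed pair is symmetric in X and Y and disappears on skewing; `key` in the other two
  -- slots is arranged likewise.
  have key : ∀ {X Y : Π x : M, Tan n x}, SmoothTanNear X x → SmoothTanNear Y x →
      (modConn D c (fun y ↦ modConn D c s y (Y y)) x (X x)).1
      = ProjProlong.covCon2 D (fun y ↦ ProjProlong.covCon2 D (fun z ↦ (s z).1) y (Y y)) x (X x)
        - symProd (D Y x (X x)) (s x).2.1
        - (symProd (Y x) (D (fun y ↦ (s y).2.1) x (X x))
          + symProd (X x) (D (fun y ↦ (s y).2.1) x (Y x)))
        + (s x).2.2 • symProd (X x) (Y x) - symProd (X x) (schoutenCon D (Y x) (s x).1)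
        + c • symProd (X x) (weylCon D (Y x) (s x).1) := by
    intro X Y hX hY
    simp only [modConn]
    rw [covCon2_sub D _ (hD.covCon2 hσ hY) (.symProd hY hμ), covCon2_symProd D _ hY hμ,
      sub_eq_add_neg _ (c • weylCon D (Y x) (s x).1), ← neg_smul,
      sub_eq_add_neg _ ((s x).2.2 • Y x), ← neg_smul,
      (symProd_linear₂ _).map_add, (symProd_linear₂ _).map_add, (symProd_linear₂ _).map_add,
      (symProd_linear₂ _).map_smul, (symProd_linear₂ _).map_smul]
    module
  have hbr := symProd_sub_left (D Y x (X x)) (D X x (Y x)) (s x).2.1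
  rw [← hD.bracket_apply hX hY] at hbr
  have htop : (modConn D c s x (VectorField.mlieBracket (𝓡 n) X Y x)).1
      = ProjProlong.covCon2 D (fun z ↦ (s z).1) x (VectorField.mlieBracket (𝓡 n) X Y x)
        - (symProd (D Y x (X x)) (s x).2.1 - symProd (D X x (Y x)) (s x).2.1) := by
    rw [← hbr]
    rfl
  have h1 : (fibCurv (modConn D c) X Y s x).1
      = (modConn D c (fun y ↦ modConn D c s y (Y y)) x (X x)).1
        - (modConn D c (fun y ↦ modConn D c s y (X y)) x (Y x)).1
        - (modConn D c s x (VectorField.mlieBracket (𝓡 n) X Y x)).1 := rfl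
  have h2 : (tractorCurv D (X x) (Y x) (s x)).1
      = ∑ i, symProd (weyl D (X x) (Y x) (tanBasis x i)) ((s x).1 (cotBasis x i)) := rfl
  rw [h1, h2, ← hD.ricci_con2_weyl hσ hσs hX hY, key hX hY, key hY hX, htop, correctionTop,
    symProd_comm (Y x) (X x)]
  module

-- No c² appears: the outer W-term acts on the top slot, which does not contain c. Skewing the terms
-- in μ leaves P(X, μ) Y - P(Y, μ) X, which turns R into W; the term P(X, Y) μ drops out by symmetry
-- of P.
set_option synthInstance.maxHeartbeats 400000 in
theorem IsTorsionFreeSmooth.modConn_mid (hD : IsTorsionFreeSmooth D)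
    (hP : ∀ v w : Tan n x, schouten D v w = schouten D w v) (c : ℝ)
    {s : Π x : M, Fib n x} (hσ : SmoothCon2Near (fun y ↦ (s y).1) x)
    (hμ : SmoothTanNear (fun y ↦ (s y).2.1) x) (hρ : SmoothFunNear n (fun y ↦ (s y).2.2) x)
    (hX : SmoothTanNear X x) (hY : SmoothTanNear Y x) :
    (fibCurv (modConn D c) X Y s x).2.1 = (tractorCurv D (X x) (Y x) (s x)).2.1
      + c • (midCorrection D (X x) (Y x) (s x) - midCorrection D (Y x) (X x) (s x)) := by
  have key : ∀ {X Y : Π x : M, Tan n x}, SmoothTanNear X x → SmoothTanNear Y x →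
      (modConn D c (fun y ↦ modConn D c s y (Y y)) x (X x)).2.1
      = D (fun y ↦ D (fun z ↦ (s z).2.1) y (Y y)) x (X x) - (s x).2.2 • D Y x (X x)
        - (ProjProlong.dFun (fun y ↦ (s y).2.2) x (X x) • Y x
          + ProjProlong.dFun (fun y ↦ (s y).2.2) x (Y x) • X x)
        + ∑ i, covSchouten D (X x) (Y x) (tanBasis x i) • (s x).1 (cotBasis x i)
        + schoutenCon D (D Y x (X x)) (s x).1
        + (schoutenCon D (Y x) (ProjProlong.covCon2 D (fun y ↦ (s y).1) x (X x))
          + schoutenCon D (X x) (ProjProlong.covCon2 D (fun y ↦ (s y).1) x (Y x)))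
        - (2 * schouten D (Y x) (s x).2.1) • X x
        - (schouten D (X x) (Y x) • (s x).2.1 + schouten D (X x) (s x).2.1 • Y x)
        + c • (midCorrection D (X x) (Y x) (s x) - weylCon D (D Y x (X x)) (s x).1
          - (weylCon D (Y x) (ProjProlong.covCon2 D (fun y ↦ (s y).1) x (X x))
            + weylCon D (X x) (ProjProlong.covCon2 D (fun y ↦ (s y).1) x (Y x)))) := by
    intro X Y hX hY
    have s1 := hD.nabla hY hμ
    have s2 := SmoothTanNear.smul hρ hY
    have s3 := hD.schoutenCon_smooth hY hσ
    have s4 := hD.weylCon_smooth hY hσ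
    have hW := hD.covWeylCon_apply (X x) hY hσ
    rw [covWeylConField] at hW
    have hS := (schoutenCon_linear₂ D (X x)).map_sub
      (ProjProlong.covCon2 D (fun y ↦ (s y).1) x (Y x)) (symProd (Y x) (s x).2.1)
    have hU := (hD.weylCon_linear₂ (X x)).map_sub
      (ProjProlong.covCon2 D (fun y ↦ (s y).1) x (Y x)) (symProd (Y x) (s x).2.1)
    simp only [modConn, midCorrection]
    rw [nabla_sub D _ ((s1.sub s2).add s3) (.smul (smoothFunNear_const c x) s4),
      nabla_add D _ (s1.sub s2) s3, nabla_sub D _ s1 s2, nabla_smul D _ hρ hY,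
      nabla_smul D _ (smoothFunNear_const c x) s4, dFun_const, hD.nabla_schoutenCon _ hY hσ,
      hS, hU, schoutenCon_symProd hD, hW]
    module
  have hcot : (2 : ℝ) • ∑ i, cotton D (X x) (Y x) (tanBasis x i) • (s x).1 (cotBasis x i)
      = ∑ i, covSchouten D (X x) (Y x) (tanBasis x i) • (s x).1 (cotBasis x i)
        - ∑ i, covSchouten D (Y x) (X x) (tanBasis x i) • (s x).1 (cotBasis x i) := by
    rw [Finset.smul_sum, ← Finset.sum_sub_distrib]
    refine Finset.sum_congr rfl fun i _ ↦ ?_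
    rw [cotton]
    module
  have hbr := hD.bracket_apply hX hY
  have hS := (hD.schoutenCon_linear₁ (s x).1).map_sub (D Y x (X x)) (D X x (Y x))
  have hU := (hD.weylCon_linear₁ (s x).1).map_sub (D Y x (X x)) (D X x (Y x))
  have hmid : (modConn D c s x (VectorField.mlieBracket (𝓡 n) X Y x)).2.1
      = D (fun z ↦ (s z).2.1) x (VectorField.mlieBracket (𝓡 n) X Y x)
        - (s x).2.2 • (D Y x (X x) - D X x (Y x))
        + (schoutenCon D (D Y x (X x)) (s x).1 - schoutenCon D (D X x (Y x)) (s x).1)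
        - c • (weylCon D (D Y x (X x)) (s x).1 - weylCon D (D X x (Y x)) (s x).1) := by
    rw [← hS, ← hU, ← hbr]
    rfl
  have hR := hD.curvField_eq hX hY hμ
  rw [curvField] at hR
  have h1 : (fibCurv (modConn D c) X Y s x).2.1
      = (modConn D c (fun y ↦ modConn D c s y (Y y)) x (X x)).2.1
        - (modConn D c (fun y ↦ modConn D c s y (X y)) x (Y x)).2.1
        - (modConn D c s x (VectorField.mlieBracket (𝓡 n) X Y x)).2.1 := rfl
  have h2 : (tractorCurv D (X x) (Y x) (s x)).2.1 = weyl D (X x) (Y x) (s x).2.1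
      + (2 : ℝ) • ∑ i, cotton D (X x) (Y x) (tanBasis x i) • (s x).1 (cotBasis x i) := rfl
  rw [h1, h2, hcot, weyl, ← hR, key hX hY, key hY hX, hmid, hP (Y x) (X x)]
  module

-- Here the outer Y-term sees only the top slot and the outer P-term is linear in the middle one, so
-- again the result is affine in c. Symmetry of P removes the ρ-term, and `schouten_schoutenCon` the
-- term in P and σ without derivatives.
set_option synthInstance.maxHeartbeats 400000 in
theorem IsTorsionFreeSmooth.modConn_bot (hD : IsTorsionFreeSmooth D)
    (hP : ∀ v w : Tan n x, schouten D v w = schouten D w v) (c : ℝ)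
    {s : Π x : M, Fib n x} (hσ : SmoothCon2Near (fun y ↦ (s y).1) x) (hσs : IsSymm2 (s x).1)
    (hμ : SmoothTanNear (fun y ↦ (s y).2.1) x) (hρ : SmoothFunNear n (fun y ↦ (s y).2.2) x)
    (hX : SmoothTanNear X x) (hY : SmoothTanNear Y x) :
    (fibCurv (modConn D c) X Y s x).2.2 = (tractorCurv D (X x) (Y x) (s x)).2.2
      + c * (botCorrection D (X x) (Y x) (s x) - botCorrection D (Y x) (X x) (s x)) := by
  have key : ∀ {X Y : Π x : M, Tan n x}, SmoothTanNear X x → SmoothTanNear Y x →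
      (modConn D c (fun y ↦ modConn D c s y (Y y)) x (X x)).2.2
      = ProjProlong.dFun (fun y ↦ ProjProlong.dFun (fun z ↦ (s z).2.2) y (Y y)) x (X x)
        + 2 * (covSchouten D (X x) (Y x) (s x).2.1 + schouten D (D Y x (X x)) (s x).2.1)
        + 2 * (schouten D (Y x) (D (fun y ↦ (s y).2.1) x (X x))
          + schouten D (X x) (D (fun y ↦ (s y).2.1) x (Y x)))
        - 2 * (s x).2.2 * schouten D (X x) (Y x)
        + 2 * schouten D (X x) (schoutenCon D (Y x) (s x).1)
        + c * (botCorrection D (X x) (Y x) (s x) - 4 * cottonCon D (D Y x (X x)) (s x).1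
          - 4 * (cottonCon D (Y x) (ProjProlong.covCon2 D (fun y ↦ (s y).1) x (X x))
            + cottonCon D (X x) (ProjProlong.covCon2 D (fun y ↦ (s y).1) x (Y x)))) := by
    intro X Y hX hY
    have s1 := hD.dFun hρ hY
    have s2 := hD.schouten_smooth hY hμ
    have s3 := hD.cottonCon_smooth hY hσ
    have hC := hD.covCottonCon_apply (X x) hY hσ
    rw [covCottonConField] at hC
    have hU := (hD.cottonCon_linear₂ (X x)).map_sub
      (ProjProlong.covCon2 D (fun y ↦ (s y).1) x (Y x)) (symProd (Y x) (s x).2.1)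
    have hS := hD.covSchouten_apply (X x) hY hμ
    simp only [modConn, botCorrection]
    rw [dFun_sub _ (s1.add (.mul (smoothFunNear_const 2 x) s2))
        (.mul (smoothFunNear_const (4 * c) x) s3),
      dFun_add _ s1 (.mul (smoothFunNear_const 2 x) s2),
      dFun_mul _ (smoothFunNear_const 2 x) s2, dFun_mul _ (smoothFunNear_const (4 * c) x) s3,
      dFun_const, dFun_const, hU, hS, hC,
      (hD.schouten_linear₂ _).map_sub, (hD.schouten_linear₂ _).map_add,
      (hD.schouten_linear₂ _).map_sub, (hD.schouten_linear₂ _).map_smul,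
      (hD.schouten_linear₂ _).map_smul, smul_eq_mul, smul_eq_mul]
    ring
  have hbr := hD.bracket_apply hX hY
  have hS := (hD.schouten_linear₁ (s x).2.1).map_sub (D Y x (X x)) (D X x (Y x))
  have hU := (hD.cottonCon_linear₁ (s x).1).map_sub (D Y x (X x)) (D X x (Y x))
  have hbot : (modConn D c s x (VectorField.mlieBracket (𝓡 n) X Y x)).2.2
      = ProjProlong.dFun (fun z ↦ (s z).2.2) x (VectorField.mlieBracket (𝓡 n) X Y x)
        + 2 * (schouten D (D Y x (X x)) (s x).2.1 - schouten D (D X x (Y x)) (s x).2.1)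
        - (4 * c) * (cottonCon D (D Y x (X x)) (s x).1 - cottonCon D (D X x (Y x)) (s x).1) := by
    rw [← hS, ← hU, ← hbr]
    rfl
  have h1 : (fibCurv (modConn D c) X Y s x).2.2
      = (modConn D c (fun y ↦ modConn D c s y (Y y)) x (X x)).2.2
        - (modConn D c (fun y ↦ modConn D c s y (X y)) x (Y x)).2.2
        - (modConn D c s x (VectorField.mlieBracket (𝓡 n) X Y x)).2.2 := rfl
  have h2 : (tractorCurv D (X x) (Y x) (s x)).2.2 = 4 * cotton D (X x) (Y x) (s x).2.1 := rfl
  rw [h1, h2, key hX hY, key hY hX, hbot, hD.dFun_bracket hρ hX hY, hP (Y x) (X x),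
    schouten_schoutenCon hD (Y x) (X x) hσs, cotton]
  ring

end curvature

theorem IsTorsionFreeSmooth.fibCurv_modConn (hD : IsTorsionFreeSmooth D)
    (hric : ∀ (x : M) (v w : Tan n x), ric D v w = ric D w v) (c : ℝ)
    {X Y : Π x : M, Tan n x} {s : Π x : M, Fib n x} (hX : SmoothTan X) (hY : SmoothTan Y)
    (hs : IsSmoothSection s) (x : M) :
    fibCurv (modConn D c) X Y s x = tractorCurv D (X x) (Y x) (s x)
      + c • (correctionTop D (X x) (Y x) (s x).1,
        midCorrection D (X x) (Y x) (s x) - midCorrection D (Y x) (X x) (s x),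
        botCorrection D (X x) (Y x) (s x) - botCorrection D (Y x) (X x) (s x)) := by
  have hP : ∀ v w : Tan n x, schouten D v w = schouten D w v := fun v w ↦ by
    rw [schouten, schouten, hric]
  have hσ := hs.smooth_top.near x
  have hμ := hs.smooth_mid.near x
  have hρ : SmoothFunNear n (fun y ↦ (s y).2.2) x := Eventually.of_forall fun y ↦ hs.smooth_bot y
  exact Prod.ext (hD.modConn_top c hσ (hs.symm x) hμ (hX.near x) (hY.near x))
    (Prod.ext (hD.modConn_mid hP c hσ hμ hρ (hX.near x) (hY.near x))
      (hD.modConn_bot hP c hσ (hs.symm x) hμ hρ (hX.near x) (hY.near x)))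

end

end ProjProlong

end

theorem mainTheorem8 {n : ℕ} (hn : 2 ≤ n) {M : Type*} [TopologicalSpace M] [T2Space M]
    [SecondCountableTopology M] [ChartedSpace (EuclideanSpace ℝ (Fin n)) M]
    [IsManifold (𝓡 n) ∞ M] (D : ProjProlong.Conn n M)
    (hD : CovariantDerivative.ContMDiffCovariantDerivative D ∞)
    (htor : D.torsion = 0)
    (hric : ∀ (x : M) (v w : ProjProlong.Tan n x),
      ProjProlong.ric D v w = ProjProlong.ric D w v) :
    (∀ (X Y : Π x : M, ProjProlong.Tan n x) (s : Π x : M, ProjProlong.Fib n x),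
      ProjProlong.SmoothTan X → ProjProlong.SmoothTan Y → ProjProlong.IsSmoothSection s →
      ∀ x, ProjProlong.fibCurv (ProjProlong.tractorConn D) X Y s x
        = ProjProlong.tractorCurv D (X x) (Y x) (s x)) ∧
    ∃ (A : Π x : M, ProjProlong.Tan n x →ₗ[ℝ] ProjProlong.Tan n x →ₗ[ℝ]
        ProjProlong.Fib n x →ₗ[ℝ] ProjProlong.Tan n x)
      (B : Π x : M, ProjProlong.Tan n x →ₗ[ℝ] ProjProlong.Tan n x →ₗ[ℝ]
        ProjProlong.Fib n x →ₗ[ℝ] ℝ),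
      (∀ x u, A x u u = 0) ∧ (∀ x u, B x u u = 0) ∧
      ∀ (X Y : Π x : M, ProjProlong.Tan n x) (s : Π x : M, ProjProlong.Fib n x),
        ProjProlong.SmoothTan X → ProjProlong.SmoothTan Y → ProjProlong.IsSmoothSection s →
        ∀ x, ProjProlong.fibCurv (ProjProlong.prolongedConn D) X Y s x
          = ProjProlong.tractorCurv D (X x) (Y x) (s x)
            + (1 / (n : ℝ)) • (ProjProlong.correctionTop D (X x) (Y x) (s x).1,
                A x (X x) (Y x) (s x), B x (X x) (Y x) (s x)) := by
  have hT : ProjProlong.IsTorsionFreeSmooth D := ⟨hD, htor, by omega⟩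
  -- The unspecified entries are the coefficients of c in the middle and bottom slots, skewed in the
  -- two directions; being trilinear maps of values at x, they depend on the section pointwise.
  refine ⟨fun X Y s hX hY hs x ↦ ?_,
    fun x ↦ ProjProlong.antisymmTrilinear (ProjProlong.midCorrection D (x := x))
      hT.midCorrection_linear₁ hT.midCorrection_linear₂ hT.midCorrection_linear₃,
    fun x ↦ ProjProlong.antisymmTrilinear (ProjProlong.botCorrection D (x := x))
      hT.botCorrection_linear₁ hT.botCorrection_linear₂ hT.botCorrection_linear₃,
    fun x u ↦ ProjProlong.antisymmTrilinear_self _ _ _ u,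
    fun x u ↦ ProjProlong.antisymmTrilinear_self _ _ _ u, fun X Y s hX hY hs x ↦ ?_⟩
  · rw [ProjProlong.tractorConn_eq, hT.fibCurv_modConn hric 0 hX hY hs, zero_smul, add_zero]
  · rw [ProjProlong.prolongedConn_eq]
    exact hT.fibCurv_modConn hric _ hX hY hs x
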